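/- Fix countably infinite, pairwise disjoint sets of constants, labeled nulls and variables, and countably many relation symbols, each with an arity $n>0$. A database is a finite set of atoms over constants (facts). A tuple-generating dependency (TGD) is a constant-free sentence $\sigma=\forall\bar x\forall\bar y\,(\varphi(\bar x,\bar y)\to\exists\bar z\,\psi(\bar x,\bar z))$ where $\varphi$ (the body) and $\psi$ (the head) are non-empty finite conjunctions of atoms; its frontier $\mathsf{fr}(\sigma)$ is the set of variables occurring in both body and head. Let $\Sigma$ be a finite set of TGDs. A trigger on an instance $I$ (a possibly infinite set of atoms over constants and nulls) is a pair $(\sigma,h)$ with $\sigma\in\Sigma$ and $h$ a homomorphism from the body of $\sigma$ to $I$. Its result is $\mu(\psi)$, where $\mu(x)=h(x)$ for $x\in\mathsf{fr}(\sigma)$, and $\mu(x)$ is the null $\bot^{x}_{\sigma,h|_{\mathsf{fr}(\sigma)}}$, uniquely named by $x$, $\sigma$ and $h|_{\mathsf{fr}(\sigma)}$, for the other variables of the head. The trigger is active on $I$ if its result is not contained in $I$. A valid (semi-oblivious) chase derivation of a database $D$ w.r.t. $\Sigma$ is a sequence of instances $D=I_0,I_1,\dots$, in which each $I_{i+1}$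 is the union of $I_i$ and the result of a trigger that is active on $I_i$, and which is either finite with no active trigger on its last instance, or infinite and fair (for every $i$, every trigger active on $I_i$ is not active on $I_j$ for some $j>i$). Its result is its last instance or, if it is infinite, the union of its instances. Let $\mathsf{CT}^{\forall}_D$ (resp. $\mathsf{CT}^{\exists}_D$) be the class of finite sets $\Sigma$ of TGDs such that every (resp. some) valid chase derivation of $D$ w.r.t. $\Sigma$ is finite. If all valid chase derivations of $D$ w.r.t. $\Sigma$ have the same result, it is denoted $\mathsf{chase}(D,\Sigma)$. Proposition. There exists a finite set $\Sigma$ of TGDs such that the following hold. (1) For every computable function $f$ from databases to $\mathbb N$, there is a database $D$ such that $\Sigma\in\mathsf{CT}^{\forall}_D\cap\mathsf{CT}^{\exists}_D$, the valid chase derivations of $D$ w.r.t. $\Sigma$ all have the same result, and $\mathsf{chase}(D,\Sigma)$ is finite with $|\mathsf{chase}(D,\Sigma)|>f(D)$. (2) The following problems are undecidable: given a database $D$, is $\Sigma\in\mathsf{CT}^{\forall}_D$? Given a database $D$, is $\Sigma\in\mathsf{CT}^{\exists}_D$? -/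

import Mathlib

namespace Chase

/-- Constants: a countably infinite set. -/
abbrev Const : Type := ℕ

/-- Variables: a countably infinite set. -/
abbrev Var : Type := ℕ

/-- Relation symbols `R/n`, each with its arity `n > 0`. -/
structure RelSym where
  name : ℕ
  arity : ℕ
  arity_pos : 0 < arity

/-- An atom `R(t₁,…,tₙ)` with arguments in `T`, where `n` is the arity of `R`. -/
structure Atom (T : Type) where
  rel : RelSym
  args : Fin rel.arity → T

/-- Apply a substitution to every argument of an atom. -/
def Atom.map {T U : Type} (g : T → U) (a : Atom T) : Atom U :=
  ⟨a.rel, fun i => g (a.args i)⟩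

/-- The set of variables occurring in a set of atoms. -/
def vars (A : Finset (Atom Var)) : Set Var :=
  {x | ∃ a ∈ A, ∃ i, a.args i = x}

/-- A (constant-free) tuple-generating dependency `φ(x̄,ȳ) → ∃ z̄, ψ(x̄,z̄)`. The conjunctions `φ` and
`ψ` are non-empty finite sets of atoms over variables; the variables of the head that do not occur
in the body are the existentially quantified ones. -/
structure TGD where
  body : Finset (Atom Var)
  head : Finset (Atom Var)
  body_nonempty : body.Nonempty
  head_nonempty : head.Nonempty

/-- The frontier: the variables that occur both in the body and in the head. -/
def TGD.frontier (σ : TGD) : Set Var := vars σ.body ∩ vars σ.head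

/-- Constants and labeled nulls. The null `⊥^x_{σ,g}` is named by a TGD `σ`, a mapping `g` of the
frontier of `σ` to constants and nulls, and a variable `x`. -/
inductive GTerm : Type where
  | const : Const → GTerm
  | null : (σ : TGD) → ({x : Var // x ∈ σ.frontier} → GTerm) → Var → GTerm

/-- Instances: possibly infinite sets of atoms with constants and nulls. -/
abbrev Inst : Type := Set (Atom GTerm)

/-- Facts: atoms whose arguments are constants. -/
abbrev Fact : Type := Atom Const

/-- Databases: finite sets of facts. -/
abbrev Database : Type := Finset Fact

/-- A database regarded as an instance. -/
def Database.toInst (D : Database) : Inst :=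
  {a | ∃ b ∈ D, a = b.map GTerm.const}

/-- `(σ, h)` is a trigger on `I`: `h` maps the body of `σ` into `I`. Only the values of `h` on the
variables of the body matter, here and in everything below. -/
def IsTrigger (I : Inst) (σ : TGD) (h : Var → GTerm) : Prop :=
  ∀ a ∈ σ.body, a.map h ∈ I

open Classical in
/-- The mapping `μ` of a trigger `(σ, h)` on the variables of the head. -/
noncomputable def headMap (σ : TGD) (h : Var → GTerm) (x : Var) : GTerm :=
  if x ∈ σ.frontier then h x else GTerm.null σ (fun y => h y.1) x

/-- The result `μ(head(σ))` of a trigger. -/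
def triggerResult (σ : TGD) (h : Var → GTerm) : Inst :=
  {a | ∃ b ∈ σ.head, a = b.map (headMap σ h)}

/-- `(σ, h)` is an active trigger on `I`. -/
def IsActive (I : Inst) (σ : TGD) (h : Var → GTerm) : Prop :=
  IsTrigger I σ h ∧ ¬ triggerResult σ h ⊆ I

/-- `J` is obtained from `I` by the application of one active trigger for `S`. -/
def Step (S : Finset TGD) (I J : Inst) : Prop :=
  ∃ σ ∈ S, ∃ h : Var → GTerm, IsActive I σ h ∧ J = I ∪ triggerResult σ h

/-- The valid (semi-oblivious) chase derivations of `D` with respect to `S`: the finite ones, that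
end in an instance without active triggers, and the infinite fair ones. -/
inductive Derivation (D : Database) (S : Finset TGD) : Type where
  | finite (n : ℕ) (I : Fin (n + 1) → Inst)
      (start : I 0 = D.toInst)
      (step : ∀ i : Fin n, Step S (I i.castSucc) (I i.succ))
      (terminal : ∀ σ ∈ S, ∀ h : Var → GTerm, ¬ IsActive (I (Fin.last n)) σ h)
  | infinite (I : ℕ → Inst)
      (start : I 0 = D.toInst)
      (step : ∀ i : ℕ, Step S (I i) (I (i + 1)))
      (fair : ∀ i : ℕ, ∀ σ ∈ S, ∀ h : Var → GTerm, IsActive (I i) σ h →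
        ∃ j, i < j ∧ ¬ IsActive (I j) σ h)

/-- The derivation is a finite sequence. -/
def Derivation.IsFinite {D : Database} {S : Finset TGD} : Derivation D S → Prop
  | .finite _ _ _ _ _ => True
  | .infinite _ _ _ _ => False

/-- The result of a valid derivation: its last instance, or the union of all its instances. -/
def Derivation.result {D : Database} {S : Finset TGD} : Derivation D S → Inst
  | .finite n I _ _ _ => I (Fin.last n)
  | .infinite I _ _ _ => ⋃ i, I i

/-- The sets of TGDs for which every valid chase derivation of `D` is finite. -/
def CTForall (D : Database) : Set (Finset TGD) :=
  {S | ∀ δ : Derivation D S, δ.IsFinite}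

/-- The sets of TGDs for which some valid chase derivation of `D` is finite. -/
def CTExists (D : Database) : Set (Finset TGD) :=
  {S | ∃ δ : Derivation D S, δ.IsFinite}

/-- `C` is `chase(D,S)`, the common result of all valid chase derivations of `D` w.r.t. `S`. -/
def IsChase (D : Database) (S : Finset TGD) (C : Inst) : Prop :=
  (∃ δ : Derivation D S, δ.result = C) ∧ ∀ δ : Derivation D S, δ.result = C

/-- A fact written as the name of its relation symbol and the list of its arguments (the arity is
the length of the list). -/
def Fact.code (a : Fact) : ℕ × List ℕ := (a.rel.name, List.ofFn a.args)

/-- `f` is computable: some algorithm computes `f D` from every list of the facts of `D`, in any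
order and with or without repetitions. -/
def ComputableOnDatabases (f : Database → ℕ) : Prop :=
  ∃ g : List (ℕ × List ℕ) → ℕ, Computable g ∧
    ∀ (D : Database) (l : List Fact), (∀ a, a ∈ l ↔ a ∈ D) → g (l.map Fact.code) = f D

/-- The property `P` of databases is decidable, for databases given by lists of their facts. -/
def DecidableOnDatabases (P : Database → Prop) : Prop :=
  ∃ g : List (ℕ × List ℕ) → Bool, Computable g ∧
    ∀ (D : Database) (l : List Fact), (∀ a, a ∈ l ↔ a ∈ D) → (g (l.map Fact.code) = true ↔ P D)

end Chase

namespace Chase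
open Turing

/-! The semi-oblivious chase names each null by the rule and the frontier values, so applying a
trigger is a monotone operation, independent of the order of application. Every valid derivation
therefore has the least closed instance above `D` as its result (`Derivation.result_eq`). It is
finite exactly when that instance is finite, because every step adds an atom
(`Derivation.isFinite_iff`). As a valid derivation always exists (`exists_derivation`), both
termination classes reduce to finiteness of `leastClosed D S`.

The fixed set `machineRules` simulates any Turing machine whose table is stored in the database. A
half-tape is a term: a null names the symbol and the rest of the tape from which it was built, so
the term determines its own content. Each configuration carries its own time and the preceding time;
the latter puts the old time into the frontier and makes the new time null fresh, even if the
machine loops. The invariant `Simulates` follows a run: at each stage all triggers at the current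
time have one common result, and all triggers at earlier times have been applied. Hence the least
closed instance is finite iff the machine halts (`finite_leastClosed_iff`), and it has more atoms
than the machine makes steps (`lt_ncard_leastClosed`).

It remains to choose the machine. A universal partial recursive `u` is compiled to a Turing machine
with input and output in unary (`exists_machine`), so that an output `m` on input `n` forces at
least `m - n` steps. Writing the inputs into databases `D n` gives `exists_databases`.
Undecidability follows from the halting problem. For a computable `f`, a self-referential index `n`
with `u n = f (D n) + n` makes the chase of `D n` halt with more than `f (D n)` atoms. -/

/-! ### The least closed instance -/

/-- An instance is closed under `S` if it has no active trigger. -/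
def Closed (S : Finset TGD) (I : Inst) : Prop :=
  ∀ σ ∈ S, ∀ h : Var → GTerm, IsTrigger I σ h → triggerResult σ h ⊆ I

/-- The least instance that contains `D` and is closed under `S`. -/
def leastClosed (D : Database) (S : Finset TGD) : Inst :=
  ⋂₀ {J | D.toInst ⊆ J ∧ Closed S J}

theorem IsTrigger.mono {I J : Inst} (hIJ : I ⊆ J) {σ : TGD} {h : Var → GTerm}
    (ht : IsTrigger I σ h) : IsTrigger J σ h :=
  fun a ha => hIJ (ht a ha)

theorem leastClosed_subset {D : Database} {S : Finset TGD} {J : Inst} (hD : D.toInst ⊆ J)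
    (hJ : Closed S J) : leastClosed D S ⊆ J :=
  Set.sInter_subset_of_mem ⟨hD, hJ⟩

theorem toInst_subset_leastClosed (D : Database) (S : Finset TGD) :
    D.toInst ⊆ leastClosed D S :=
  Set.subset_sInter fun _ hJ => hJ.1

theorem closed_leastClosed (D : Database) (S : Finset TGD) : Closed S (leastClosed D S) :=
  fun σ hσ h ht => Set.subset_sInter fun _ hJ =>
    hJ.2 σ hσ h (ht.mono (leastClosed_subset hJ.1 hJ.2))

theorem finite_toInst (D : Database) : D.toInst.Finite := by
  refine (D.finite_toSet.image (Atom.map GTerm.const)).subset ?_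
  rintro a ⟨b, hb, rfl⟩
  exact ⟨b, hb, rfl⟩

theorem finite_triggerResult (σ : TGD) (h : Var → GTerm) : (triggerResult σ h).Finite := by
  refine (σ.head.finite_toSet.image (Atom.map (headMap σ h))).subset ?_
  rintro a ⟨b, hb, rfl⟩
  exact ⟨b, hb, rfl⟩

theorem Step.subset {S : Finset TGD} {I J : Inst} (hs : Step S I J) : I ⊆ J := by
  obtain ⟨σ, -, h, -, rfl⟩ := hs
  exact Set.subset_union_left

theorem Step.finite {S : Finset TGD} {I J : Inst} (hs : Step S I J) (hI : I.Finite) :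
    J.Finite := by
  obtain ⟨σ, -, h, -, rfl⟩ := hs
  exact hI.union (finite_triggerResult σ h)

theorem Step.subset_of_closed {S : Finset TGD} {I J K : Inst} (hs : Step S I J) (hK : Closed S K)
    (hI : I ⊆ K) : J ⊆ K := by
  obtain ⟨σ, hσ, h, ha, rfl⟩ := hs
  exact Set.union_subset hI (hK σ hσ h (ha.1.mono hI))

theorem Step.exists_new {S : Finset TGD} {I J : Inst} (hs : Step S I J) : ∃ a ∈ J, a ∉ I := by
  obtain ⟨σ, hσ, h, ha, rfl⟩ := hs
  obtain ⟨a, ha, hI⟩ := Set.not_subset.1 ha.2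
  exact ⟨a, Or.inr ha, hI⟩

/-- A strictly increasing sequence of chase steps has an infinite union. -/
theorem infinite_iUnion_of_step {S : Finset TGD} {I : ℕ → Inst}
    (step : ∀ i, Step S (I i) (I (i + 1))) : (⋃ i, I i).Infinite := by
  have hmono : Monotone I := monotone_nat_of_le_succ fun i => (step i).subset
  choose a ha ha' using fun i => (step i).exists_new
  refine Set.infinite_of_injective_forall_mem (f := a) ?_
    fun i => Set.mem_iUnion.2 ⟨i + 1, ha i⟩
  intro i j hij
  by_contra hne
  rcases lt_or_gt_of_ne hne with hlt | hlt
  · exact ha' j (hij ▸ hmono hlt (ha i))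
  · exact ha' i (hij ▸ hmono hlt (ha j))

/-- A trigger on the union of an increasing sequence is a trigger on one of its members. -/
theorem IsTrigger.exists_of_iUnion {I : ℕ → Inst} (hmono : Monotone I) {σ : TGD}
    {h : Var → GTerm} (ht : IsTrigger (⋃ i, I i) σ h) : ∃ i, IsTrigger (I i) σ h := by
  choose f hf using fun a : σ.body => Set.mem_iUnion.1 (ht a.1 a.2)
  -- The body is finite, so the stages at which its atoms appear have a common upper bound.
  refine ⟨Finset.univ.sup f, fun a ha => ?_⟩
  exact hmono (Finset.le_sup (f := f) (Finset.mem_univ ⟨a, ha⟩)) (hf ⟨a, ha⟩)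

/-- Each step stays inside every closed instance above `D`; conversely the result is itself closed,
by termination in the finite case and by fairness in the infinite one. -/
theorem Derivation.result_eq {D : Database} {S : Finset TGD} (δ : Derivation D S) :
    δ.result = leastClosed D S := by
  cases δ with
  | finite n I start step terminal =>
    have hsub : ∀ i : Fin (n + 1), D.toInst ⊆ I i ∧ I i ⊆ leastClosed D S := by
      intro i
      induction i using Fin.induction with
      | zero => exact ⟨start.ge, start ▸ toInst_subset_leastClosed D S⟩
      | succ i ih =>
        exact ⟨ih.1.trans (step i).subset,
          (step i).subset_of_closed (closed_leastClosed D S) ih.2⟩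
    refine Set.Subset.antisymm (hsub _).2 (leastClosed_subset (hsub _).1 ?_)
    intro σ hσ h ht
    by_contra hc
    exact terminal σ hσ h ⟨ht, hc⟩
  | infinite I start step fair =>
    have hmono : Monotone I := monotone_nat_of_le_succ fun i => (step i).subset
    have hsub : ∀ i, I i ⊆ leastClosed D S := by
      intro i
      induction i with
      | zero => exact start ▸ toInst_subset_leastClosed D S
      | succ i ih => exact (step i).subset_of_closed (closed_leastClosed D S) ih
    refine Set.Subset.antisymm (Set.iUnion_subset hsub) (leastClosed_subset ?_ ?_)
    · exact start ▸ Set.subset_iUnion I 0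
    · intro σ hσ h ht
      obtain ⟨i, hi⟩ := ht.exists_of_iUnion hmono
      by_cases hc : triggerResult σ h ⊆ I i
      · exact hc.trans (Set.subset_iUnion I i)
      -- Triggers persist in larger instances, so the only way to become inactive is that the result
      -- has been added.
      · obtain ⟨j, hij, hj⟩ := fair i σ hσ h ⟨hi, hc⟩
        by_contra hc'
        exact hj ⟨hi.mono (hmono hij.le), fun hs => hc' (hs.trans (Set.subset_iUnion I j))⟩

theorem Derivation.isFinite_iff {D : Database} {S : Finset TGD} (δ : Derivation D S) :
    δ.IsFinite ↔ (leastClosed D S).Finite := by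
  rw [← δ.result_eq]
  cases δ with
  | finite n I start step terminal =>
    refine iff_of_true trivial ?_
    have hfin : ∀ i : Fin (n + 1), (I i).Finite := by
      intro i
      induction i using Fin.induction with
      | zero => exact start ▸ finite_toInst D
      | succ i ih => exact (step i).finite ih
    exact hfin _
  | infinite I start step fair =>
    exact iff_of_false id (infinite_iUnion_of_step step)

/-! ### Countability of the set of ground terms -/

instance {T : Type} [Countable T] : Countable (Atom T) := by
  have h1 : Countable RelSym :=
    Function.Injective.countable (f := fun r : RelSym => (r.name, r.arity)) (by
      rintro ⟨a, b, _⟩ ⟨c, d, _⟩ h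
      simp only [Prod.mk.injEq] at h
      obtain ⟨rfl, rfl⟩ := h
      rfl)
  exact Function.Injective.countable
    (f := fun a : Atom T => (⟨a.rel, a.args⟩ : Σ r : RelSym, Fin r.arity → T)) (by
      rintro ⟨a, b⟩ ⟨c, d⟩ h
      simp only [Sigma.mk.injEq] at h
      obtain ⟨rfl, h⟩ := h
      rw [eq_of_heq h])

instance : Countable TGD :=
  Function.Injective.countable (f := fun σ : TGD => (σ.body, σ.head)) (by
    rintro ⟨a, b, _, _⟩ ⟨c, d, _, _⟩ h
    simp only [Prod.mk.injEq] at h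
    obtain ⟨rfl, rfl⟩ := h
    rfl)

theorem finite_vars (A : Finset (Atom Var)) : (vars A).Finite := by
  have : vars A = ⋃ a ∈ A, Set.range a.args := by
    ext x
    simp [vars]
  rw [this]
  exact A.finite_toSet.biUnion fun a _ => Set.finite_range _

theorem finite_frontier (σ : TGD) : σ.frontier.Finite :=
  (finite_vars σ.body).subset Set.inter_subset_left

/-- The children of a node of the tree of a ground term. -/
def TermArity : Const ⊕ (TGD × Var) → Type
  | .inl _ => Empty
  | .inr p => {x : Var // x ∈ p.1.frontier}

/-- A ground term as a well-founded tree. -/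
def GTerm.toWType : GTerm → WType TermArity
  | .const c => ⟨.inl c, Empty.elim⟩
  | .null σ g x => ⟨.inr (σ, x), fun y => (g y).toWType⟩

theorem GTerm.toWType_injective : Function.Injective GTerm.toWType := by
  intro s
  induction s with
  | const c =>
    intro t h
    cases t with
    | const d =>
      injection h with h _
      rw [Sum.inl.inj h]
    | null σ g x =>
      injection h with h _
      exact absurd h Sum.inl_ne_inr
  | null σ g x ih =>
    intro t h
    cases t with
    | const d =>
      injection h with h _
      exact absurd h Sum.inr_ne_inl
    | null τ k y =>
      injection h with h1 h2
      obtain ⟨rfl, rfl⟩ := Prod.mk.inj (Sum.inr.inj h1)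
      have : g = k := funext fun z => ih z (congrFun (eq_of_heq h2) z)
      rw [this]

/-- Well-founded trees with countably many labels and finite branching are countable; the branching
at a null is finite because frontiers are. The numbering of atoms that this provides is used to
schedule fair derivations. -/
instance : Countable GTerm := by
  have : ∀ a, Finite (TermArity a) := by
    rintro (c | p)
    · exact inferInstanceAs (Finite Empty)
    · exact (finite_frontier p.1).to_subtype
  have := fun a => Fintype.ofFinite (TermArity a)
  have := fun a => Fintype.toEncodable (TermArity a)
  have := Encodable.ofCountable (Const ⊕ (TGD × Var))
  exact GTerm.toWType_injective.countable

/-! ### Existence of valid derivations -/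

/-- The triggers of `S`. -/
abbrev Trig (S : Finset TGD) : Type := {σ // σ ∈ S} × (Var → GTerm)

/-- A bound on the numbers of the atoms in the result of a trigger. -/
theorem exists_rank (e : Atom GTerm → ℕ) (σ : TGD) (h : Var → GTerm) :
    ∃ k, ∀ a ∈ triggerResult σ h, e a ≤ k := by
  obtain ⟨k, hk⟩ := ((finite_triggerResult σ h).image e).bddAbove
  exact ⟨k, fun a ha => hk ⟨a, ha, rfl⟩⟩

/-- Number all atoms, let the rank of a trigger bound the numbers in its result, and always apply an
active trigger of least rank. A trigger active forever would force infinitely many new atoms below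
its own rank. -/
theorem exists_derivation (D : Database) (S : Finset TGD) : Nonempty (Derivation D S) := by
  classical
  obtain ⟨e, he⟩ := exists_injective_nat (Atom GTerm)
  choose rank hrank using fun p : Trig S => exists_rank e p.1.1 p.2
  have hnext : ∀ I : Inst, ∃ J : Inst, (∃ p : Trig S, IsActive I p.1.1 p.2) →
      ∃ p : Trig S, IsActive I p.1.1 p.2 ∧ J = I ∪ triggerResult p.1.1 p.2 ∧
        ∀ q : Trig S, IsActive I q.1.1 q.2 → rank p ≤ rank q := by
    intro I
    by_cases hI : ∃ p : Trig S, IsActive I p.1.1 p.2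
    · obtain ⟨p, hp, hmin⟩ :=
        WellFounded.has_min (measure rank).wf {p : Trig S | IsActive I p.1.1 p.2} hI
      exact ⟨_, fun _ => ⟨p, hp, rfl, fun q hq => not_lt.1 (hmin q hq)⟩⟩
    · exact ⟨I, fun h => absurd h hI⟩
  choose next hnext using hnext
  let I : ℕ → Inst := fun n => next^[n] D.toInst
  have hsucc : ∀ n, I (n + 1) = next (I n) := fun n => Function.iterate_succ_apply' next n _
  have hstep : ∀ n, (∃ p : Trig S, IsActive (I n) p.1.1 p.2) → Step S (I n) (I (n + 1)) := by
    intro n hn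
    obtain ⟨p, hp, hJ, -⟩ := hnext (I n) hn
    exact ⟨p.1.1, p.1.2, p.2, hp, (hsucc n).trans hJ⟩
  by_cases hterm : ∃ n, ¬ ∃ p : Trig S, IsActive (I n) p.1.1 p.2
  · refine ⟨.finite (Nat.find hterm) (fun i => I i) rfl (fun i => ?_) fun σ hσ h ha => ?_⟩
    · exact hstep i (not_not.1 (Nat.find_min hterm i.2))
    · exact Nat.find_spec hterm ⟨(⟨σ, hσ⟩, h), ha⟩
  · push Not at hterm
    have hst : ∀ n, Step S (I n) (I (n + 1)) := fun n => hstep n (hterm n)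
    have hmono : Monotone I := monotone_nat_of_le_succ fun i => (hst i).subset
    refine ⟨.infinite I rfl hst fun i σ hσ h ha => ?_⟩
    by_contra hcon
    push Not at hcon
    -- The neglected trigger competes at every later stage, so the trigger chosen there has at most
    -- its rank.
    have hnew : ∀ j, ∃ a ∈ I (i + 1 + j + 1), a ∉ I (i + 1 + j) ∧ e a ≤ rank (⟨σ, hσ⟩, h) := by
      intro j
      obtain ⟨p, hp, hJ, hmin⟩ := hnext (I (i + 1 + j)) (hterm _)
      obtain ⟨a, ha, ha'⟩ := Set.not_subset.1 hp.2
      refine ⟨a, ?_, ha', (hrank p a ha).trans (hmin (⟨σ, hσ⟩, h) (hcon _ (by omega)))⟩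
      rw [hsucc, hJ]
      exact Or.inr ha
    choose a ha1 ha2 ha3 using hnew
    have hinj : Function.Injective a := by
      intro j k hjk
      by_contra hne
      rcases lt_or_gt_of_ne hne with hlt | hlt
      · exact ha2 k (hjk ▸ hmono (by omega) (ha1 j))
      · exact ha2 j (hjk ▸ hmono (by omega) (ha1 k))
    refine Set.infinite_of_injective_forall_mem (he.comp hinj) (fun j => ?_)
      (Set.finite_Iic (rank (⟨σ, hσ⟩, h)))
    exact ha3 j

/-! ### Termination and the least closed instance -/

/-- Existence of a derivation excludes that the universal condition holds vacuously. -/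
theorem mem_CTForall_iff {D : Database} {S : Finset TGD} :
    S ∈ CTForall D ↔ (leastClosed D S).Finite := by
  obtain ⟨δ⟩ := exists_derivation D S
  exact ⟨fun h => δ.isFinite_iff.1 (h δ), fun h δ => δ.isFinite_iff.2 h⟩

theorem mem_CTExists_iff {D : Database} {S : Finset TGD} :
    S ∈ CTExists D ↔ (leastClosed D S).Finite := by
  obtain ⟨δ⟩ := exists_derivation D S
  exact ⟨fun ⟨δ, h⟩ => δ.isFinite_iff.1 h, fun h => ⟨δ, δ.isFinite_iff.2 h⟩⟩

theorem isChase_leastClosed (D : Database) (S : Finset TGD) : IsChase D S (leastClosed D S) := by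
  obtain ⟨δ⟩ := exists_derivation D S
  exact ⟨⟨δ, δ.result_eq⟩, fun δ => δ.result_eq⟩

/-! ### The rules -/

/-- The atom of a configuration: the previous and the current time, the state, the left part of the
tape, the scanned symbol, and the right part of the tape. -/
def confA {T : Type} (p t q l s r : T) : Atom T := ⟨⟨0, 6, by norm_num⟩, ![p, t, q, l, s, r]⟩

/-- The half-tape `z` consists of the symbol `s` followed by the half-tape `w`. -/
def cellA {T : Type} (z s w : T) : Atom T := ⟨⟨1, 3, by norm_num⟩, ![z, s, w]⟩

/-- In state `q` on symbol `s`, the machine moves in direction `d` and goes to state `q'`. -/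
def moveA {T : Type} (d : Turing.Dir) (q s q' : T) : Atom T :=
  ⟨⟨if d = .left then 2 else 3, 3, by norm_num⟩, ![q, s, q']⟩

/-- In state `q` on symbol `s`, the machine writes `s'` and goes to state `q'`. -/
def writeA {T : Type} (q s q' s' : T) : Atom T := ⟨⟨4, 4, by norm_num⟩, ![q, s, q', s']⟩

/-- The atom of a configuration, with the part `x` of the tape that the head leaves and the part `y`
that the head enters when it moves in direction `d`. -/
def confD {T : Type} (d : Turing.Dir) (p t q x s y : T) : Atom T :=
  match d with
  | .left => confA p t q y s x
  | .right => confA p t q x s y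

section
variable {T U : Type}

@[simp] theorem confA_map (g : T → U) (p t q l s r : T) :
    (confA p t q l s r).map g = confA (g p) (g t) (g q) (g l) (g s) (g r) := by
  simp only [Atom.map, confA, Atom.mk.injEq, heq_eq_eq, true_and]
  funext i; fin_cases i <;> rfl

@[simp] theorem cellA_map (g : T → U) (z s w : T) :
    (cellA z s w).map g = cellA (g z) (g s) (g w) := by
  simp only [Atom.map, cellA, Atom.mk.injEq, heq_eq_eq, true_and]
  funext i; fin_cases i <;> rfl

@[simp] theorem moveA_map (g : T → U) (d : Turing.Dir) (q s q' : T) :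
    (moveA d q s q').map g = moveA d (g q) (g s) (g q') := by
  simp only [Atom.map, moveA, Atom.mk.injEq, heq_eq_eq, true_and]
  funext i; fin_cases i <;> rfl

@[simp] theorem writeA_map (g : T → U) (q s q' s' : T) :
    (writeA q s q' s').map g = writeA (g q) (g s) (g q') (g s') := by
  simp only [Atom.map, writeA, Atom.mk.injEq, heq_eq_eq, true_and]
  funext i; fin_cases i <;> rfl

@[simp] theorem confD_map (g : T → U) (d : Turing.Dir) (p t q l s r : T) :
    (confD d p t q l s r).map g = confD d (g p) (g t) (g q) (g l) (g s) (g r) := by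
  cases d <;> simp [confD]

@[simp] theorem confA_inj {p t q l s r p' t' q' l' s' r' : T} :
    confA p t q l s r = confA p' t' q' l' s' r' ↔
      p = p' ∧ t = t' ∧ q = q' ∧ l = l' ∧ s = s' ∧ r = r' := by
  simp [confA, funext_iff, Fin.forall_fin_succ]

@[simp] theorem cellA_inj {z s w z' s' w' : T} :
    cellA z s w = cellA z' s' w' ↔ z = z' ∧ s = s' ∧ w = w' := by
  simp [cellA, funext_iff, Fin.forall_fin_succ]

@[simp] theorem moveA_inj {d d' : Turing.Dir} {q s x q' s' x' : T} :
    moveA d q s x = moveA d' q' s' x' ↔ d = d' ∧ q = q' ∧ s = s' ∧ x = x' := by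
  cases d <;> cases d' <;> simp [moveA, funext_iff, Fin.forall_fin_succ]

@[simp] theorem writeA_inj {q s x y q' s' x' y' : T} :
    writeA q s x y = writeA q' s' x' y' ↔ q = q' ∧ s = s' ∧ x = x' ∧ y = y' := by
  simp [writeA, funext_iff, Fin.forall_fin_succ]

theorem Atom.ne_of_name_ne {a b : Atom T} (h : a.rel.name ≠ b.rel.name) : a ≠ b :=
  fun hab => h (hab ▸ rfl)

@[simp] theorem confA_ne_cellA {p t q l s r z u w : T} : confA p t q l s r ≠ cellA z u w :=
  Atom.ne_of_name_ne (by simp [confA, cellA])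

@[simp] theorem confA_ne_moveA {p t q l s r z u w : T} {d : Turing.Dir} :
    confA p t q l s r ≠ moveA d z u w :=
  Atom.ne_of_name_ne (by cases d <;> simp [confA, moveA])

@[simp] theorem confA_ne_writeA {p t q l s r z u w v : T} : confA p t q l s r ≠ writeA z u w v :=
  Atom.ne_of_name_ne (by simp [confA, writeA])

@[simp] theorem cellA_ne_moveA {q l s z u w : T} {d : Turing.Dir} : cellA q l s ≠ moveA d z u w :=
  Atom.ne_of_name_ne (by cases d <;> simp [cellA, moveA])

@[simp] theorem cellA_ne_writeA {q l s z u w v : T} : cellA q l s ≠ writeA z u w v :=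
  Atom.ne_of_name_ne (by simp [cellA, writeA])

@[simp] theorem moveA_ne_writeA {q l s z u w v : T} {d : Turing.Dir} :
    moveA d q l s ≠ writeA z u w v :=
  Atom.ne_of_name_ne (by cases d <;> simp [moveA, writeA])

end

open Classical in
/-- The rule for the moves in direction `d`. -/
noncomputable def moveTGD (d : Turing.Dir) : TGD where
  body := {confD d 0 1 2 3 4 5, moveA d 2 4 6, cellA 5 7 8}
  head := {cellA 9 4 3, confD d 1 10 6 9 7 8}
  body_nonempty := ⟨_, Finset.mem_insert_self _ _⟩
  head_nonempty := ⟨_, Finset.mem_insert_self _ _⟩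

open Classical in
/-- The rule for writing. -/
noncomputable def writeTGD : TGD where
  body := {confA 0 1 2 3 4 5, writeA 2 4 6 7}
  head := {confA 1 10 6 3 7 5}
  body_nonempty := ⟨_, Finset.mem_insert_self _ _⟩
  head_nonempty := ⟨_, Finset.mem_singleton_self _⟩

open Classical in
/-- The rules that simulate the Turing machine whose table is in the database. -/
noncomputable def machineRules : Finset TGD := {moveTGD .left, moveTGD .right, writeTGD}

theorem mem_machineRules {σ : TGD} :
    σ ∈ machineRules ↔ (∃ d, σ = moveTGD d) ∨ σ = writeTGD := by
  simp only [machineRules, Finset.mem_insert, Finset.mem_singleton]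
  constructor
  · rintro (h | h | h)
    exacts [.inl ⟨_, h⟩, .inl ⟨_, h⟩, .inr h]
  · rintro (⟨_ | _, h⟩ | h) <;> simp [h]

theorem mem_frontier_moveTGD {d : Turing.Dir} {x : Var} :
    x ∈ (moveTGD d).frontier ↔ x = 1 ∨ x = 3 ∨ x = 4 ∨ x = 6 ∨ x = 7 ∨ x = 8 := by
  cases d <;>
  · simp only [TGD.frontier, vars, moveTGD, confD, confA, cellA, moveA, Set.mem_inter_iff,
      Set.mem_ofPred_eq, Finset.mem_insert, Finset.mem_singleton, exists_eq_or_imp, exists_eq_left,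
      Fin.exists_fin_succ]
    simp
    grind

theorem mem_frontier_writeTGD {x : Var} :
    x ∈ writeTGD.frontier ↔ x = 1 ∨ x = 3 ∨ x = 5 ∨ x = 6 ∨ x = 7 := by
  simp only [TGD.frontier, vars, writeTGD, confA, writeA, Set.mem_inter_iff,
      Set.mem_ofPred_eq, Finset.mem_insert, Finset.mem_singleton, exists_eq_or_imp, exists_eq_left,
      Fin.exists_fin_succ]
  simp
  grind

theorem isTrigger_moveTGD {I : Inst} {d : Turing.Dir} {h : Var → GTerm} :
    IsTrigger I (moveTGD d) h ↔ confD d (h 0) (h 1) (h 2) (h 3) (h 4) (h 5) ∈ I ∧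
      moveA d (h 2) (h 4) (h 6) ∈ I ∧ cellA (h 5) (h 7) (h 8) ∈ I := by
  simp [IsTrigger, moveTGD]

theorem isTrigger_writeTGD {I : Inst} {h : Var → GTerm} :
    IsTrigger I writeTGD h ↔ confA (h 0) (h 1) (h 2) (h 3) (h 4) (h 5) ∈ I ∧
      writeA (h 2) (h 4) (h 6) (h 7) ∈ I := by
  simp [IsTrigger, writeTGD]

/-- The null for `x` that the trigger `(σ, h)` introduces. -/
def newNull (σ : TGD) (h : Var → GTerm) (x : Var) : GTerm := .null σ (fun y => h y.1) x

theorem triggerResult_moveTGD (d : Turing.Dir) (h : Var → GTerm) :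
    triggerResult (moveTGD d) h = {cellA (newNull (moveTGD d) h 9) (h 4) (h 3),
      confD d (h 1) (newNull (moveTGD d) h 10) (h 6) (newNull (moveTGD d) h 9) (h 7) (h 8)} := by
  ext a
  simp [triggerResult, moveTGD]
  simp [headMap, ← moveTGD.eq_1, mem_frontier_moveTGD, newNull]

theorem triggerResult_writeTGD (h : Var → GTerm) :
    triggerResult writeTGD h =
      {confA (h 1) (newNull writeTGD h 10) (h 6) (h 3) (h 7) (h 5)} := by
  ext a
  simp [triggerResult, writeTGD]
  simp [headMap, ← writeTGD.eq_1, mem_frontier_writeTGD, newNull]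

/-- This is where the semi-oblivious naming of nulls enters: body variables outside the frontier do
not influence the result. -/
theorem triggerResult_congr {σ : TGD} {h k : Var → GTerm} (hk : ∀ x ∈ σ.frontier, h x = k x) :
    triggerResult σ h = triggerResult σ k := by
  have : headMap σ h = headMap σ k := by
    funext x
    have h2 : (fun y : {x // x ∈ σ.frontier} => h y.1) = fun y => k y.1 :=
      funext fun y => hk y.1 y.2
    by_cases hx : x ∈ σ.frontier
    · simp [headMap, hx, hk x hx]
    · simp [headMap, hx, h2]
  rw [triggerResult, triggerResult, this]

/-! ### Half-tapes as terms -/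

open Classical in
/-- The argument of a null for the frontier variable `x`. -/
noncomputable def nullArg (σ : TGD) (g : {x : Var // x ∈ σ.frontier} → GTerm) (x : Var) : GTerm :=
  if h : x ∈ σ.frontier then g ⟨x, h⟩ else .const 0

/-- The first symbol of the half-tape denoted by a term; the half-tapes denoted by constants are
given by `sym`. -/
noncomputable def headOf (sym : ℕ → ℕ) : GTerm → GTerm
  | .const c => .const (sym c)
  | .null σ g _ => nullArg σ g 4

/-- The rest of the half-tape denoted by a term. -/
noncomputable def tailOf : GTerm → GTerm
  | .const c => .const (c - 1)
  | .null σ g _ => nullArg σ g 3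

open Classical in
/-- The number of steps after which a term that denotes a time is introduced. -/
noncomputable def age : GTerm → ℕ
  | .const _ => 0
  | .null σ g _ => if h : (1 : Var) ∈ σ.frontier then age (g ⟨1, h⟩) + 1 else 0

/-- Every rule keeps the current time, variable `1`, in its head as the previous time, so a null
remembers it. Ages serve to prove that time nulls are fresh. -/
theorem age_newNull {σ : TGD} (hσ : σ ∈ machineRules) (h : Var → GTerm) (x : Var) :
    age (newNull σ h x) = age (h 1) + 1 := by
  have : (1 : Var) ∈ σ.frontier := by
    rcases mem_machineRules.1 hσ with ⟨d, rfl⟩ | rfl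
    · simp [mem_frontier_moveTGD]
    · simp [mem_frontier_writeTGD]
  simp [newNull, age, this]

theorem headOf_newNull_moveTGD (sym : ℕ → ℕ) (d : Dir) (h : Var → GTerm) (x : Var) :
    headOf sym (newNull (moveTGD d) h x) = h 4 := by
  simp [newNull, headOf, nullArg, mem_frontier_moveTGD]

theorem tailOf_newNull_moveTGD (d : Dir) (h : Var → GTerm) (x : Var) :
    tailOf (newNull (moveTGD d) h x) = h 3 := by
  simp [newNull, tailOf, nullArg, mem_frontier_moveTGD]

/-- The instance contains the first cell of the half-tape `z`. -/
def HasCell (sym : ℕ → ℕ) (I : Inst) (z : GTerm) : Prop :=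
  cellA z (headOf sym z) (tailOf z) ∈ I

section
variable {Γ Λ : Type} [Inhabited Γ] [Inhabited Λ]

/-- The term `z` denotes the half-tape `L`, and the instance contains its cells. -/
def Denotes (γ : Γ → ℕ) (sym : ℕ → ℕ) (I : Inst) (z : GTerm) (L : ListBlank Γ) : Prop :=
  ∀ i, headOf sym (tailOf^[i] z) = .const (γ (L.nth i)) ∧ HasCell sym I (tailOf^[i] z)

variable {γ : Γ → ℕ} {sym : ℕ → ℕ} {I J : Inst}

theorem Denotes.mono {z : GTerm} {L : ListBlank Γ} (h : Denotes γ sym I z L) (hIJ : I ⊆ J) :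
    Denotes γ sym J z L :=
  fun i => ⟨(h i).1, hIJ (h i).2⟩

theorem Denotes.tail {z : GTerm} {L : ListBlank Γ} (h : Denotes γ sym I z L) :
    Denotes γ sym I (tailOf z) L.tail := by
  intro i
  simpa only [Function.iterate_succ_apply, ListBlank.nth_succ] using h (i + 1)

theorem Denotes.head {z : GTerm} {L : ListBlank Γ} (h : Denotes γ sym I z L) :
    headOf sym z = .const (γ L.head) := by
  simpa using (h 0).1

theorem Denotes.hasCell {z : GTerm} {L : ListBlank Γ} (h : Denotes γ sym I z L) :
    HasCell sym I z :=
  (h 0).2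

theorem Denotes.cons {z : GTerm} {L : ListBlank Γ} {a : Γ} (h : Denotes γ sym I (tailOf z) L)
    (hz : headOf sym z = .const (γ a)) (hc : HasCell sym I z) :
    Denotes γ sym I z (L.cons a) := by
  rintro (_ | i)
  · simpa using ⟨hz, hc⟩
  · simpa only [Function.iterate_succ_apply, ListBlank.nth_succ, ListBlank.tail_cons] using h i

/-! ### The simulation -/

/-- The database `D` holds the table of the machine `M` on the states in `S`, a configuration with
the initial state and scanned symbol `a₀`, and cells. -/
structure HoldsMachine (M : TM0.Machine Γ Λ) (S : Set Λ) (κ : Λ → ℕ) (γ : Γ → ℕ) (sym : ℕ → ℕ)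
    (a₀ : Γ) (n : ℕ) (D : Database) : Prop where
  supports : TM0.Supports M S
  state_inj : Set.InjOn κ S
  symbol_inj : Function.Injective γ
  move_mem : ∀ q ∈ S, ∀ a q' d, M q a = some (q', .move d) → moveA d (κ q) (γ a) (κ q') ∈ D
  write_mem : ∀ q ∈ S, ∀ a q' b, M q a = some (q', .write b) →
    writeA (κ q) (γ a) (κ q') (γ b) ∈ D
  of_move_mem : ∀ d x y z, moveA d x y z ∈ D → ∃ q ∈ S, ∃ a q', M q a = some (q', .move d) ∧
    x = κ q ∧ y = γ a ∧ z = κ q'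
  of_write_mem : ∀ x y z w, writeA x y z w ∈ D → ∃ q ∈ S, ∃ a q' b,
    M q a = some (q', .write b) ∧ x = κ q ∧ y = γ a ∧ z = κ q' ∧ w = γ b
  conf_mem : confA 0 0 (κ default) 0 (γ a₀) n ∈ D
  of_conf_mem : ∀ p t q l s r, confA p t q l s r ∈ D →
    confA p t q l s r = confA 0 0 (κ default) 0 (γ a₀) n
  cell_mem : ∀ c ≤ n, cellA c (sym c) (c - 1) ∈ D
  of_cell_mem : ∀ z s w, cellA z s w ∈ D → s = sym z ∧ w = z - 1

variable {M : TM0.Machine Γ Λ} {S : Set Λ} {κ : Λ → ℕ} {a₀ : Γ} {n₀ : ℕ} {D : Database}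

/-- The instance `I` is what the chase has generated when the simulation has arrived, after `n`
steps, at the configuration `c`, whose atom is given by `p`, `t`, `l` and `r`. -/
structure Simulates (S : Set Λ) (κ : Λ → ℕ) (γ : Γ → ℕ) (sym : ℕ → ℕ) (D : Database)
    (n : ℕ) (c : TM0.Cfg Γ Λ) (I : Inst) (p t l r : GTerm) : Prop where
  finite : I.Finite
  toInst_subset : D.toInst ⊆ I
  subset : I ⊆ leastClosed D machineRules
  lt_ncard : n < I.ncard
  state_mem : c.q ∈ S
  conf_mem : confA p t (.const (κ c.q)) l (.const (γ c.Tape.head)) r ∈ I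
  left : Denotes γ sym I l c.Tape.left
  right : Denotes γ sym I r c.Tape.right
  age_eq : age t = n
  of_conf_mem : ∀ p' t' q' l' s' r', confA p' t' q' l' s' r' ∈ I →
    age t' ≤ n ∧ HasCell sym I l' ∧ HasCell sym I r' ∧
      (t' = t → confA p' t' q' l' s' r' =
        confA p t (.const (κ c.q)) l (.const (γ c.Tape.head)) r)
  of_cell_mem : ∀ z s w, cellA z s w ∈ I → s = headOf sym z ∧ w = tailOf z
  of_move_mem : ∀ d x y z, moveA d x y z ∈ I → moveA d x y z ∈ D.toInst
  of_write_mem : ∀ x y z w, writeA x y z w ∈ I → writeA x y z w ∈ D.toInst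
  result_subset : ∀ σ ∈ machineRules, ∀ h, IsTrigger I σ h → h 1 ≠ t → triggerResult σ h ⊆ I

/-! ### Reading the facts of the database as atoms of the instance -/

theorem toInst_confA {p t q l s r : GTerm} : confA p t q l s r ∈ D.toInst ↔
    ∃ p' t' q' l' s' r', confA p' t' q' l' s' r' ∈ D ∧ confA p t q l s r =
      confA (.const p') (.const t') (.const q') (.const l') (.const s') (.const r') := by
  constructor
  · rintro ⟨b, hb, hab⟩
    obtain ⟨R, args⟩ := b
    obtain rfl : R = ⟨0, 6, by norm_num⟩ := (congrArg Atom.rel hab).symm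
    have : (⟨⟨0, 6, by norm_num⟩, args⟩ : Fact) =
        confA (args 0) (args 1) (args 2) (args 3) (args 4) (args 5) := by
      simp only [confA, Atom.mk.injEq, heq_eq_eq, true_and]
      funext i; fin_cases i <;> rfl
    rw [this] at hb hab
    exact ⟨_, _, _, _, _, _, hb, by simpa using hab⟩
  · rintro ⟨p', t', q', l', s', r', hb, h⟩
    exact ⟨_, hb, by simpa using h⟩

theorem toInst_cellA {z s w : GTerm} : cellA z s w ∈ D.toInst ↔
    ∃ z' s' w', cellA z' s' w' ∈ D ∧ z = .const z' ∧ s = .const s' ∧ w = .const w' := by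
  constructor
  · rintro ⟨b, hb, hab⟩
    obtain ⟨R, args⟩ := b
    obtain rfl : R = ⟨1, 3, by norm_num⟩ := (congrArg Atom.rel hab).symm
    have : (⟨⟨1, 3, by norm_num⟩, args⟩ : Fact) = cellA (args 0) (args 1) (args 2) := by
      simp only [cellA, Atom.mk.injEq, heq_eq_eq, true_and]
      funext i; fin_cases i <;> rfl
    rw [this] at hb hab
    exact ⟨_, _, _, hb, by simpa using hab⟩
  · rintro ⟨z', s', w', hb, rfl, rfl, rfl⟩
    exact ⟨_, hb, by simp⟩

theorem toInst_moveA {d : Dir} {x y z : GTerm} : moveA d x y z ∈ D.toInst ↔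
    ∃ x' y' z', moveA d x' y' z' ∈ D ∧ x = .const x' ∧ y = .const y' ∧ z = .const z' := by
  constructor
  · rintro ⟨b, hb, hab⟩
    obtain ⟨R, args⟩ := b
    obtain rfl : R = ⟨if d = .left then 2 else 3, 3, by norm_num⟩ := (congrArg Atom.rel hab).symm
    have : (⟨⟨if d = .left then 2 else 3, 3, by norm_num⟩, args⟩ : Fact) =
        moveA d (args 0) (args 1) (args 2) := by
      simp only [moveA, Atom.mk.injEq, heq_eq_eq, true_and]
      funext i; fin_cases i <;> rfl
    rw [this] at hb hab
    exact ⟨_, _, _, hb, by simpa using hab⟩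
  · rintro ⟨x', y', z', hb, rfl, rfl, rfl⟩
    exact ⟨_, hb, by simp⟩

theorem toInst_writeA {x y z w : GTerm} : writeA x y z w ∈ D.toInst ↔
    ∃ x' y' z' w', writeA x' y' z' w' ∈ D ∧ x = .const x' ∧ y = .const y' ∧ z = .const z' ∧
      w = .const w' := by
  constructor
  · rintro ⟨b, hb, hab⟩
    obtain ⟨R, args⟩ := b
    obtain rfl : R = ⟨4, 4, by norm_num⟩ := (congrArg Atom.rel hab).symm
    have : (⟨⟨4, 4, by norm_num⟩, args⟩ : Fact) =
        writeA (args 0) (args 1) (args 2) (args 3) := by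
      simp only [writeA, Atom.mk.injEq, heq_eq_eq, true_and]
      funext i; fin_cases i <;> rfl
    rw [this] at hb hab
    exact ⟨_, _, _, _, hb, by simpa using hab⟩
  · rintro ⟨x', y', z', w', hb, rfl, rfl, rfl, rfl⟩
    exact ⟨_, hb, by simp⟩

namespace HoldsMachine

-- The encodings are injective on supported states and on symbols, so a fact of the table can be
-- decoded uniquely.
omit [Inhabited Γ] in
theorem move_iff (H : HoldsMachine M S κ γ sym a₀ n₀ D) {q : Λ} (hq : q ∈ S) {a : Γ} {d : Dir}
    {x : GTerm} : moveA d (.const (κ q)) (.const (γ a)) x ∈ D.toInst ↔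
      ∃ q', M q a = some (q', .move d) ∧ x = .const (κ q') := by
  rw [toInst_moveA]
  constructor
  · rintro ⟨x', y', z', hmem, hx, hy, rfl⟩
    obtain ⟨q₁, hq₁, a₁, q', hM, rfl, rfl, rfl⟩ := H.of_move_mem _ _ _ _ hmem
    simp only [GTerm.const.injEq] at hx hy
    obtain rfl := H.state_inj hq hq₁ hx
    obtain rfl := H.symbol_inj hy
    exact ⟨q', hM, rfl⟩
  · rintro ⟨q', hM, rfl⟩
    exact ⟨_, _, _, H.move_mem q hq a q' d hM, rfl, rfl, rfl⟩

omit [Inhabited Γ] in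
theorem write_iff (H : HoldsMachine M S κ γ sym a₀ n₀ D) {q : Λ} (hq : q ∈ S) {a : Γ}
    {x y : GTerm} : writeA (.const (κ q)) (.const (γ a)) x y ∈ D.toInst ↔
      ∃ q' b, M q a = some (q', .write b) ∧ x = .const (κ q') ∧ y = .const (γ b) := by
  rw [toInst_writeA]
  constructor
  · rintro ⟨x', y', z', w', hmem, hx, hy, rfl, rfl⟩
    obtain ⟨q₁, hq₁, a₁, q', b, hM, rfl, rfl, rfl, rfl⟩ := H.of_write_mem _ _ _ _ hmem
    simp only [GTerm.const.injEq] at hx hy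
    obtain rfl := H.state_inj hq hq₁ hx
    obtain rfl := H.symbol_inj hy
    exact ⟨q', b, hM, rfl, rfl⟩
  · rintro ⟨q', b, hM, rfl, rfl⟩
    exact ⟨_, _, _, _, H.write_mem q hq a q' b hM, rfl, rfl, rfl, rfl⟩

end HoldsMachine

/-- A trigger for the rules uses the atom of a configuration, whose time is the value of the
variable `1`. -/
theorem IsTrigger.exists_conf {σ : TGD} (hσ : σ ∈ machineRules) {h : Var → GTerm}
    (ht : IsTrigger I σ h) : ∃ p q l s r, confA p (h 1) q l s r ∈ I := by
  rcases mem_machineRules.1 hσ with ⟨d, rfl⟩ | rfl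
  · cases d
    · exact ⟨_, _, _, _, _, (isTrigger_moveTGD.1 ht).1⟩
    · exact ⟨_, _, _, _, _, (isTrigger_moveTGD.1 ht).1⟩
  · exact ⟨_, _, _, _, _, (isTrigger_writeTGD.1 ht).1⟩

namespace Simulates

variable {n : ℕ} {c : TM0.Cfg Γ Λ} {p t l r : GTerm}

/-- The trigger that a move of the machine leads to. -/
theorem eq_of_isTrigger_moveTGD (H : HoldsMachine M S κ γ sym a₀ n₀ D)
    (hI : Simulates S κ γ sym D n c I p t l r) {d : Dir} {h : Var → GTerm}
    (ht : IsTrigger I (moveTGD d) h) (h1 : h 1 = t) :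
    ∃ q', M c.q c.Tape.head = some (q', .move d) ∧ h 6 = .const (κ q') ∧
      h 4 = .const (γ c.Tape.head) ∧ h 7 = headOf sym (h 5) ∧ h 8 = tailOf (h 5) ∧
      h 3 = (if d = .left then r else l) ∧
      h 5 = (if d = .left then l else r) := by
  obtain ⟨hconf, hmove, hcell⟩ := isTrigger_moveTGD.1 ht
  obtain ⟨h7, h8⟩ := hI.of_cell_mem _ _ _ hcell
  have hmove := hI.of_move_mem _ _ _ _ hmove
  cases d
  · have := (hI.of_conf_mem _ _ _ _ _ _ hconf).2.2.2 h1
    simp only [confA_inj] at this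
    obtain ⟨-, -, h2, h5, h4, h3⟩ := this
    rw [h2, h4, H.move_iff hI.state_mem] at hmove
    obtain ⟨q', hM, h6⟩ := hmove
    exact ⟨q', hM, h6, h4, h7, h8, by simp [h3], by simp [h5]⟩
  · have := (hI.of_conf_mem _ _ _ _ _ _ hconf).2.2.2 h1
    simp only [confA_inj] at this
    obtain ⟨-, -, h2, h3, h4, h5⟩ := this
    rw [h2, h4, H.move_iff hI.state_mem] at hmove
    obtain ⟨q', hM, h6⟩ := hmove
    exact ⟨q', hM, h6, h4, h7, h8, by simp [h3], by simp [h5]⟩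

theorem eq_of_isTrigger_writeTGD (H : HoldsMachine M S κ γ sym a₀ n₀ D)
    (hI : Simulates S κ γ sym D n c I p t l r) {h : Var → GTerm}
    (ht : IsTrigger I writeTGD h) (h1 : h 1 = t) :
    ∃ q' b, M c.q c.Tape.head = some (q', .write b) ∧ h 6 = .const (κ q') ∧
      h 7 = .const (γ b) ∧ h 3 = l ∧ h 5 = r := by
  obtain ⟨hconf, hwrite⟩ := isTrigger_writeTGD.1 ht
  have hwrite := hI.of_write_mem _ _ _ _ hwrite
  have := (hI.of_conf_mem _ _ _ _ _ _ hconf).2.2.2 h1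
  simp only [confA_inj] at this
  obtain ⟨-, -, h2, h3, h4, h5⟩ := this
  rw [h2, h4, H.write_iff hI.state_mem] at hwrite
  obtain ⟨q', b, hM, h6, h7⟩ := hwrite
  exact ⟨q', b, hM, h6, h7, h3, h5⟩

/-- When the machine halts, the instance is closed. -/
theorem closed_of_halt (H : HoldsMachine M S κ γ sym a₀ n₀ D)
    (hI : Simulates S κ γ sym D n c I p t l r) (hM : M c.q c.Tape.head = none) :
    Closed machineRules I := by
  intro σ hσ h ht
  by_cases h1 : h 1 = t
  · rcases mem_machineRules.1 hσ with ⟨d, rfl⟩ | rfl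
    · obtain ⟨q', hM', -⟩ := hI.eq_of_isTrigger_moveTGD H ht h1
      simp [hM] at hM'
    · obtain ⟨q', b, hM', -⟩ := hI.eq_of_isTrigger_writeTGD H ht h1
      simp [hM] at hM'
  · exact hI.result_subset σ hσ h ht h1

/-- All triggers that use the atom of the current configuration have the same result. -/
theorem triggerResult_eq (H : HoldsMachine M S κ γ sym a₀ n₀ D)
    (hI : Simulates S κ γ sym D n c I p t l r) {σ τ : TGD} (hσ : σ ∈ machineRules)
    (hτ : τ ∈ machineRules) {h k : Var → GTerm} (hh : IsTrigger I σ h) (hk : IsTrigger I τ k)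
    (h1 : h 1 = t) (k1 : k 1 = t) : triggerResult σ h = triggerResult τ k := by
  rcases mem_machineRules.1 hσ with ⟨d, rfl⟩ | rfl <;>
    rcases mem_machineRules.1 hτ with ⟨e, rfl⟩ | rfl
  · obtain ⟨q, hM, h6, h4, h7, h8, h3, h5⟩ := hI.eq_of_isTrigger_moveTGD H hh h1
    obtain ⟨q', hM', k6, k4, k7, k8, k3, k5⟩ := hI.eq_of_isTrigger_moveTGD H hk k1
    simp only [hM, Option.some.injEq, Prod.mk.injEq, TM0.Stmt.move.injEq] at hM'
    obtain ⟨rfl, rfl⟩ := hM'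
    refine triggerResult_congr fun x hx => ?_
    rcases mem_frontier_moveTGD.1 hx with rfl | rfl | rfl | rfl | rfl | rfl
    · rw [h1, k1]
    · rw [h3, k3]
    · rw [h4, k4]
    · rw [h6, k6]
    · rw [h7, k7, h5, k5]
    · rw [h8, k8, h5, k5]
  · obtain ⟨q, hM, -⟩ := hI.eq_of_isTrigger_moveTGD H hh h1
    obtain ⟨q', b, hM', -⟩ := hI.eq_of_isTrigger_writeTGD H hk k1
    simp [hM] at hM'
  · obtain ⟨q, b, hM, -⟩ := hI.eq_of_isTrigger_writeTGD H hh h1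
    obtain ⟨q', hM', -⟩ := hI.eq_of_isTrigger_moveTGD H hk k1
    simp [hM] at hM'
  · obtain ⟨q, b, hM, h6, h7, h3, h5⟩ := hI.eq_of_isTrigger_writeTGD H hh h1
    obtain ⟨q', b', hM', k6, k7, k3, k5⟩ := hI.eq_of_isTrigger_writeTGD H hk k1
    simp only [hM, Option.some.injEq, Prod.mk.injEq, TM0.Stmt.write.injEq] at hM'
    obtain ⟨rfl, rfl⟩ := hM'
    refine triggerResult_congr fun x hx => ?_
    rcases mem_frontier_writeTGD.1 hx with rfl | rfl | rfl | rfl | rfl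
    · rw [h1, k1]
    · rw [h3, k3]
    · rw [h5, k5]
    · rw [h6, k6]
    · rw [h7, k7]

/-- The effect of the application of a trigger that uses the atom of the current configuration. -/
theorem apply_trigger (H : HoldsMachine M S κ γ sym a₀ n₀ D)
    (hI : Simulates S κ γ sym D n c I p t l r) {σ : TGD} (hσ : σ ∈ machineRules)
    {h : Var → GTerm} (ht : IsTrigger I σ h) (h1 : h 1 = t) {c' : TM0.Cfg Γ Λ} {t' l' r' : GTerm}
    (hS : c'.q ∈ S) (hage : age t' = n + 1)
    (hmem : confA t t' (.const (κ c'.q)) l' (.const (γ c'.Tape.head)) r' ∈ triggerResult σ h)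
    (hres : ∀ a ∈ triggerResult σ h,
      a = confA t t' (.const (κ c'.q)) l' (.const (γ c'.Tape.head)) r' ∨
        ∃ z, a = cellA z (headOf sym z) (tailOf z))
    (hl : Denotes γ sym (I ∪ triggerResult σ h) l' c'.Tape.left)
    (hr : Denotes γ sym (I ∪ triggerResult σ h) r' c'.Tape.right) :
    Simulates S κ γ sym D (n + 1) c' (I ∪ triggerResult σ h) t t' l' r' where
  finite := hI.finite.union (finite_triggerResult σ h)
  toInst_subset := hI.toInst_subset.trans Set.subset_union_left
  subset := Set.union_subset hI.subset
    (closed_leastClosed D machineRules σ hσ h (ht.mono hI.subset))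
  lt_ncard := by
    refine (Nat.succ_le_of_lt hI.lt_ncard).trans_lt (Set.ncard_lt_ncard ?_
      (hI.finite.union (finite_triggerResult σ h)))
    -- The new configuration has age `n + 1`, while all times in `I` have age at most `n`.
    refine Set.ssubset_iff_exists.2 ⟨Set.subset_union_left, _, Or.inr hmem, fun h' => ?_⟩
    have := (hI.of_conf_mem _ _ _ _ _ _ h').1
    omega
  state_mem := hS
  conf_mem := Or.inr hmem
  left := hl
  right := hr
  age_eq := hage
  of_conf_mem := by
    rintro p₁ t₁ q₁ l₁ s₁ r₁ (h' | h')
    · obtain ⟨ha, hl₁, hr₁, -⟩ := hI.of_conf_mem _ _ _ _ _ _ h'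
      refine ⟨by omega, Or.inl hl₁, Or.inl hr₁, ?_⟩
      rintro rfl
      omega
    · rcases hres _ h' with h' | ⟨z, h'⟩
      · simp only [h', implies_true, and_true]
        simp only [confA_inj] at h'
        obtain ⟨-, rfl, -, rfl, -, rfl⟩ := h'
        exact ⟨hage.le, hl.hasCell, hr.hasCell⟩
      · simp at h'
  of_cell_mem := by
    rintro z s w (h' | h')
    · exact hI.of_cell_mem _ _ _ h'
    · rcases hres _ h' with h' | ⟨z', h'⟩
      · exact absurd h'.symm confA_ne_cellA
      · simp only [cellA_inj] at h'
        obtain ⟨rfl, rfl, rfl⟩ := h'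
        exact ⟨rfl, rfl⟩
  of_move_mem := by
    rintro d x y z (h' | h')
    · exact hI.of_move_mem _ _ _ _ h'
    · rcases hres _ h' with h' | ⟨z', h'⟩
      · exact absurd h'.symm confA_ne_moveA
      · exact absurd h'.symm cellA_ne_moveA
  of_write_mem := by
    rintro x y z w (h' | h')
    · exact hI.of_write_mem _ _ _ _ h'
    · rcases hres _ h' with h' | ⟨z', h'⟩
      · exact absurd h'.symm confA_ne_writeA
      · exact absurd h'.symm cellA_ne_writeA
  result_subset := by
    have hconf : ∀ p₁ t₁ q₁ l₁ s₁ r₁, confA p₁ t₁ q₁ l₁ s₁ r₁ ∈ I ∪ triggerResult σ h → t₁ ≠ t' →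
        confA p₁ t₁ q₁ l₁ s₁ r₁ ∈ I := by
      rintro p₁ t₁ q₁ l₁ s₁ r₁ (h' | h') hne
      · exact h'
      · rcases hres _ h' with h' | ⟨z, h'⟩
        · exact absurd (confA_inj.1 h').2.1 hne
        · exact absurd h' confA_ne_cellA
    have hcell : ∀ z s w, cellA z s w ∈ I ∪ triggerResult σ h → HasCell sym I z →
        cellA z s w ∈ I := by
      rintro z s w (h' | h') hz
      · exact h'
      · rcases hres _ h' with h' | ⟨z', h'⟩
        · exact absurd h'.symm confA_ne_cellA
        · obtain ⟨rfl, rfl, rfl⟩ := cellA_inj.1 h'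
          exact hz
    intro τ hτ k hk k1
    -- A trigger at a time other than `t'` uses an old configuration. Its half-tapes already have
    -- their cells in `I`, and a term determines its cell, so the whole trigger lies in `I`. It then
    -- either shares the result just added or was dealt with before.
    have hk' : IsTrigger I τ k := by
      rcases mem_machineRules.1 hτ with ⟨d, rfl⟩ | rfl
      · obtain ⟨hk1, hk2, hk3⟩ := isTrigger_moveTGD.1 hk
        have hk2' : moveA d (k 2) (k 4) (k 6) ∈ I := by
          rcases hk2 with h' | h'
          · exact h'
          · rcases hres _ h' with h' | ⟨z', h'⟩
            · exact absurd h'.symm confA_ne_moveA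
            · exact absurd h'.symm cellA_ne_moveA
        cases d
        · have hk1' := hconf _ _ _ _ _ _ hk1 k1
          exact isTrigger_moveTGD.2 ⟨hk1', hk2',
            hcell _ _ _ hk3 (hI.of_conf_mem _ _ _ _ _ _ hk1').2.1⟩
        · have hk1' := hconf _ _ _ _ _ _ hk1 k1
          exact isTrigger_moveTGD.2 ⟨hk1', hk2',
            hcell _ _ _ hk3 (hI.of_conf_mem _ _ _ _ _ _ hk1').2.2.1⟩
      · obtain ⟨hk1, hk2⟩ := isTrigger_writeTGD.1 hk
        refine isTrigger_writeTGD.2 ⟨hconf _ _ _ _ _ _ hk1 k1, ?_⟩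
        rcases hk2 with h' | h'
        · exact h'
        · rcases hres _ h' with h' | ⟨z', h'⟩
          · exact absurd h'.symm confA_ne_writeA
          · exact absurd h'.symm cellA_ne_writeA
    by_cases hkt : k 1 = t
    · rw [hI.triggerResult_eq H hτ hσ hk' ht hkt h1]
      exact Set.subset_union_right
    · exact (hI.result_subset τ hτ k hk' hkt).trans Set.subset_union_left

/-- A move pushes the scanned symbol onto the half-tape left behind, as a new null, and pops the
half-tape entered; a write changes only state, symbol and time. -/
theorem step (H : HoldsMachine M S κ γ sym a₀ n₀ D)
    (hI : Simulates S κ γ sym D n c I p t l r) {c' : TM0.Cfg Γ Λ} (hc : c' ∈ TM0.step M c) :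
    ∃ I' p' t' l' r', Simulates S κ γ sym D (n + 1) c' I' p' t' l' r' := by
  have hS := TM0.step_supports M H.supports hc hI.state_mem
  obtain ⟨q, T⟩ := c
  obtain ⟨⟨q', s⟩, hM, rfl⟩ := Option.map_eq_some_iff.1 hc
  have hq := hI.state_mem
  have hconf := hI.conf_mem
  have hL := hI.left
  have hR := hI.right
  rcases s with (_ | _) | b
  -- The entries are the values of the variables `0` to `8`. Moving left leaves `r` behind (variable
  -- `3`) and enters `l` (variable `5`); the default value `t` is irrelevant.
  · let h : ℕ → GTerm := fun x => [p, t, .const (κ q), r, .const (γ T.head), l, .const (κ q'),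
      headOf sym l, tailOf l].getD x t
    have hage := (age_newNull (mem_machineRules.2 (.inl ⟨.left, rfl⟩)) h 10).trans
      (congrArg (· + 1) hI.age_eq)
    have ht : IsTrigger I (moveTGD .left) h := isTrigger_moveTGD.2 ⟨hconf,
      hI.toInst_subset ((H.move_iff hq).2 ⟨q', hM, rfl⟩), hL.hasCell⟩
    have hhd : h 7 = .const (γ T.left.head) := hL.head
    have hz : cellA (newNull (moveTGD .left) h 9) (headOf sym (newNull (moveTGD .left) h 9))
        (tailOf (newNull (moveTGD .left) h 9)) ∈ triggerResult (moveTGD .left) h := by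
      rw [triggerResult_moveTGD, headOf_newNull_moveTGD, tailOf_newNull_moveTGD]
      exact Or.inl rfl
    refine ⟨I ∪ triggerResult (moveTGD .left) h, t, newNull (moveTGD .left) h 10, tailOf l,
      newNull (moveTGD .left) h 9,
      hI.apply_trigger (t' := newNull (moveTGD .left) h 10) (c' := ⟨q', T.move .left⟩) H
        (mem_machineRules.2 (.inl ⟨.left, rfl⟩)) ht rfl hS hage ?_ ?_ ?_ ?_⟩
    · rw [triggerResult_moveTGD, hhd]
      exact Or.inr rfl
    · intro a ha
      rw [triggerResult_moveTGD, hhd] at ha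
      rcases ha with rfl | rfl
      · refine Or.inr ⟨newNull (moveTGD .left) h 9, ?_⟩
        rw [headOf_newNull_moveTGD, tailOf_newNull_moveTGD]
      · exact Or.inl rfl
    · exact hL.tail.mono Set.subset_union_left
    · refine Denotes.cons ?_ (headOf_newNull_moveTGD sym _ h 9) (Or.inr hz)
      rw [tailOf_newNull_moveTGD]
      exact hR.mono Set.subset_union_left
  · let h : ℕ → GTerm := fun x => [p, t, .const (κ q), l, .const (γ T.head), r, .const (κ q'),
      headOf sym r, tailOf r].getD x t
    have hage := (age_newNull (mem_machineRules.2 (.inl ⟨.right, rfl⟩)) h 10).trans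
      (congrArg (· + 1) hI.age_eq)
    have ht : IsTrigger I (moveTGD .right) h := isTrigger_moveTGD.2 ⟨hconf,
      hI.toInst_subset ((H.move_iff hq).2 ⟨q', hM, rfl⟩), hR.hasCell⟩
    have hhd : h 7 = .const (γ T.right.head) := hR.head
    have hz : cellA (newNull (moveTGD .right) h 9) (headOf sym (newNull (moveTGD .right) h 9))
        (tailOf (newNull (moveTGD .right) h 9)) ∈ triggerResult (moveTGD .right) h := by
      rw [triggerResult_moveTGD, headOf_newNull_moveTGD, tailOf_newNull_moveTGD]
      exact Or.inl rfl
    refine ⟨I ∪ triggerResult (moveTGD .right) h, t, newNull (moveTGD .right) h 10,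
      newNull (moveTGD .right) h 9, tailOf r,
      hI.apply_trigger (t' := newNull (moveTGD .right) h 10) (c' := ⟨q', T.move .right⟩) H
        (mem_machineRules.2 (.inl ⟨.right, rfl⟩)) ht rfl hS hage ?_ ?_ ?_ ?_⟩
    · rw [triggerResult_moveTGD, hhd]
      exact Or.inr rfl
    · intro a ha
      rw [triggerResult_moveTGD, hhd] at ha
      rcases ha with rfl | rfl
      · refine Or.inr ⟨newNull (moveTGD .right) h 9, ?_⟩
        rw [headOf_newNull_moveTGD, tailOf_newNull_moveTGD]
      · exact Or.inl rfl
    · refine Denotes.cons ?_ (headOf_newNull_moveTGD sym _ h 9) (Or.inr hz)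
      rw [tailOf_newNull_moveTGD]
      exact hL.mono Set.subset_union_left
    · exact hR.tail.mono Set.subset_union_left
  · let h : ℕ → GTerm := fun x => [p, t, .const (κ q), l, .const (γ T.head), r, .const (κ q'),
      .const (γ b)].getD x t
    have hage := (age_newNull (mem_machineRules.2 (.inr rfl)) h 10).trans
      (congrArg (· + 1) hI.age_eq)
    have ht : IsTrigger I writeTGD h := isTrigger_writeTGD.2 ⟨hconf,
      hI.toInst_subset ((H.write_iff hq).2 ⟨q', b, hM, rfl, rfl⟩)⟩
    refine ⟨I ∪ triggerResult writeTGD h, t, newNull writeTGD h 10, l, r,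
      hI.apply_trigger (t' := newNull writeTGD h 10) (c' := ⟨q', T.write b⟩) H
        (mem_machineRules.2 (.inr rfl)) ht rfl hS hage ?_ ?_ ?_ ?_⟩
    · rw [triggerResult_writeTGD]
      rfl
    · intro a ha
      rw [triggerResult_writeTGD] at ha
      exact Or.inl ha
    · exact hL.mono Set.subset_union_left
    · exact hR.mono Set.subset_union_left

end Simulates

/-- The half-tape denoted by a constant of the database. -/
theorem denotes_const (H : HoldsMachine M S κ γ sym a₀ n₀ D) {L : ListBlank Γ} {m : ℕ}
    (hm : m ≤ n₀) (hL : ∀ i, sym (m - i) = γ (L.nth i)) :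
    Denotes γ sym D.toInst (.const m) L := by
  have htail : ∀ i, tailOf^[i] (.const m) = .const (m - i) := by
    intro i
    -- Truncated subtraction makes the constant `0` its own tail, so it denotes an infinite blank
    -- half-tape once `sym 0` is blank.
    induction i with
    | zero => rfl
    | succ i ih => rw [Function.iterate_succ_apply', ih, tailOf, Nat.sub_sub]
  intro i
  rw [htail]
  exact ⟨congrArg GTerm.const (hL i),
    toInst_cellA.2 ⟨_, _, _, H.cell_mem (m - i) (by omega), rfl, rfl, rfl⟩⟩

/-- The database simulates the initial configuration. -/
theorem HoldsMachine.simulates (H : HoldsMachine M S κ γ sym a₀ n₀ D) {T : Tape Γ}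
    (hhead : T.head = a₀) (hleft : ∀ i, T.left.nth i = default)
    (hright : ∀ i, sym (n₀ - i) = γ (T.right.nth i)) (h0 : sym 0 = γ default) :
    Simulates S κ γ sym D 0 ⟨default, T⟩ D.toInst (.const 0) (.const 0) (.const 0) (.const n₀) := by
  have hL : Denotes γ sym D.toInst (.const 0) T.left :=
    denotes_const H (Nat.zero_le _) fun i => by rw [Nat.zero_sub, h0, hleft]
  have hR : Denotes γ sym D.toInst (.const n₀) T.right := denotes_const H le_rfl hright
  have hconf : confA (.const 0) (.const 0) (.const (κ default)) (.const 0) (.const (γ T.head))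
      (.const n₀) ∈ D.toInst :=
    toInst_confA.2 ⟨_, _, _, _, _, _, H.conf_mem, by rw [hhead]⟩
  have hinit : ∀ p' t' q' l' s' r', confA p' t' q' l' s' r' ∈ D.toInst →
      confA p' t' q' l' s' r' = confA (.const 0) (.const 0) (.const (κ default)) (.const 0)
        (.const (γ T.head)) (.const n₀) := by
    intro p' t' q' l' s' r' h
    obtain ⟨p₁, t₁, q₁, l₁, s₁, r₁, h₁, h₂⟩ := toInst_confA.1 h
    obtain ⟨rfl, rfl, rfl, rfl, rfl, rfl⟩ := confA_inj.1 (H.of_conf_mem _ _ _ _ _ _ h₁)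
    rw [h₂, hhead]
  exact
  { finite := finite_toInst D
    toInst_subset := subset_rfl
    subset := toInst_subset_leastClosed D _
    lt_ncard := (Set.ncard_pos (finite_toInst D)).2 ⟨_, hconf⟩
    state_mem := H.supports.1
    conf_mem := hconf
    left := hL
    right := hR
    age_eq := rfl
    of_conf_mem := by
      intro p' t' q' l' s' r' h
      have h' := hinit _ _ _ _ _ _ h
      obtain ⟨rfl, rfl, rfl, rfl, rfl, rfl⟩ := confA_inj.1 h'
      exact ⟨le_rfl, hL.hasCell, hR.hasCell, fun _ => rfl⟩
    of_cell_mem := by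
      intro z s w h
      obtain ⟨z', s', w', hmem, rfl, rfl, rfl⟩ := toInst_cellA.1 h
      obtain ⟨rfl, rfl⟩ := H.of_cell_mem _ _ _ hmem
      exact ⟨rfl, rfl⟩
    of_move_mem := fun _ _ _ _ h => h
    of_write_mem := fun _ _ _ _ h => h
    result_subset := by
      intro σ hσ h ht h1
      obtain ⟨p, q, l, s, r, hc⟩ := ht.exists_conf hσ
      exact absurd (confA_inj.1 (hinit _ _ _ _ _ _ hc)).2.1 h1 }

/-! ### Runs of the machine and the size of the chase -/

/-- The configuration of the machine after `n` steps. -/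
def stepN (M : TM0.Machine Γ Λ) (c : TM0.Cfg Γ Λ) : ℕ → Option (TM0.Cfg Γ Λ)
  | 0 => some c
  | n + 1 => (stepN M c n).bind (TM0.step M)

theorem exists_simulates (H : HoldsMachine M S κ γ sym a₀ n₀ D) {c c' : TM0.Cfg Γ Λ}
    {p t l r : GTerm} (h0 : Simulates S κ γ sym D 0 c D.toInst p t l r) {n : ℕ}
    (hn : c' ∈ stepN M c n) : ∃ I p t l r, Simulates S κ γ sym D n c' I p t l r := by
  induction n generalizing c' with
  | zero =>
    obtain rfl := Option.some.inj hn
    exact ⟨_, _, _, _, _, h0⟩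
  | succ n ih =>
    obtain ⟨c₁, h₁, h₂⟩ := Option.bind_eq_some_iff.1 hn
    obtain ⟨I, p, t, l, r, hI⟩ := ih h₁
    exact hI.step H h₂

theorem exists_stepN_of_reaches {c c' : TM0.Cfg Γ Λ}
    (h : StateTransition.Reaches (TM0.step M) c c') : ∃ n, c' ∈ stepN M c n := by
  induction h with
  | refl => exact ⟨0, rfl⟩
  | tail _ hs ih =>
    obtain ⟨n, hn⟩ := ih
    exact ⟨n + 1, Option.bind_eq_some_iff.2 ⟨_, hn, hs⟩⟩

theorem reaches_of_mem_stepN {c c' : TM0.Cfg Γ Λ} {n : ℕ} (h : c' ∈ stepN M c n) :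
    StateTransition.Reaches (TM0.step M) c c' := by
  induction n generalizing c' with
  | zero =>
    obtain rfl := Option.some.inj h
    exact .refl
  | succ n ih =>
    obtain ⟨c₁, h₁, h₂⟩ := Option.bind_eq_some_iff.1 h
    exact (ih h₁).tail h₂

/-- A machine that does not halt runs for any number of steps. -/
theorem exists_mem_stepN_of_not_dom {c : TM0.Cfg Γ Λ}
    (h : ¬ (StateTransition.eval (TM0.step M) c).Dom) (n : ℕ) : ∃ c', c' ∈ stepN M c n := by
  induction n with
  | zero => exact ⟨c, rfl⟩
  | succ n ih =>
    obtain ⟨c₁, h₁⟩ := ih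
    cases hs : TM0.step M c₁ with
    | none =>
      exact absurd (Part.dom_iff_mem.2
        ⟨c₁, StateTransition.mem_eval.2 ⟨reaches_of_mem_stepN h₁, hs⟩⟩) h
    | some c₂ => exact ⟨c₂, Option.bind_eq_some_iff.2 ⟨c₁, h₁, hs⟩⟩

/-- The least closed instance is finite if and only if the machine halts. -/
theorem finite_leastClosed_iff (H : HoldsMachine M S κ γ sym a₀ n₀ D) {c : TM0.Cfg Γ Λ}
    {p t l r : GTerm} (h0 : Simulates S κ γ sym D 0 c D.toInst p t l r) :
    (leastClosed D machineRules).Finite ↔ (StateTransition.eval (TM0.step M) c).Dom := by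
  constructor
  · intro hfin
    by_contra h
    -- Running for as many steps as there are atoms already produces too many atoms.
    obtain ⟨c', hc'⟩ := exists_mem_stepN_of_not_dom h (leastClosed D machineRules).ncard
    obtain ⟨I, p, t, l, r, hI⟩ := exists_simulates H h0 hc'
    exact absurd (Set.ncard_le_ncard hI.subset hfin) hI.lt_ncard.not_ge
  · intro h
    obtain ⟨c', hc'⟩ := Part.dom_iff_mem.1 h
    obtain ⟨hr, hn⟩ := StateTransition.mem_eval.1 hc'
    obtain ⟨n, hn'⟩ := exists_stepN_of_reaches hr
    obtain ⟨I, p, t, l, r, hI⟩ := exists_simulates H h0 hn'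
    refine hI.finite.subset (leastClosed_subset hI.toInst_subset (hI.closed_of_halt H ?_))
    exact Option.map_eq_none_iff.1 hn

/-- The least closed instance has more atoms than the machine makes steps. -/
theorem lt_ncard_leastClosed (H : HoldsMachine M S κ γ sym a₀ n₀ D) {c c' : TM0.Cfg Γ Λ}
    {p t l r : GTerm} (h0 : Simulates S κ γ sym D 0 c D.toInst p t l r) {n : ℕ}
    (hn : c' ∈ stepN M c n) (hfin : (leastClosed D machineRules).Finite) :
    n < (leastClosed D machineRules).ncard := by
  obtain ⟨I, p, t, l, r, hI⟩ := exists_simulates H h0 hn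
  exact hI.lt_ncard.trans_le (Set.ncard_le_ncard hI.subset hfin)
end
/-! ### A universal Turing machine -/

section
variable {Γ Λ : Type} [Inhabited Γ] [Inhabited Λ]

/-- A machine writes at most one new cell in each step. -/
theorem nth_eq_default_of_mem_stepN {M : TM0.Machine Γ Λ} {c c' : TM0.Cfg Γ Λ} {B k : ℕ}
    (hc : ∀ i : ℤ, B < |i| → c.Tape.nth i = default) (hk : c' ∈ stepN M c k) :
    ∀ i : ℤ, (B + k : ℕ) < |i| → c'.Tape.nth i = default := by
  induction k generalizing c' with
  | zero =>
    obtain rfl := Option.some.inj hk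
    exact hc
  | succ k ih =>
    obtain ⟨⟨q, T⟩, h₁, h₂⟩ := Option.bind_eq_some_iff.1 hk
    obtain ⟨⟨q', s⟩, -, rfl⟩ := Option.map_eq_some_iff.1 h₂
    intro i hi
    push_cast at hi
    have ih := ih h₁
    rcases s with (_ | _) | b
    · refine (Tape.move_left_nth T i).trans (ih (i - 1) ?_)
      have := abs_sub_abs_le_abs_sub i 1
      push_cast
      rw [abs_one] at this
      omega
    · refine (Tape.move_right_nth T i).trans (ih (i + 1) ?_)
      have := abs_sub_abs_le_abs_sub i (-1)
      rw [abs_neg, abs_one, sub_neg_eq_add] at this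
      push_cast
      omega
    · have hi0 : i ≠ 0 := by
        rintro rfl
        rw [abs_zero] at hi
        omega
      refine (Tape.write_nth b T).trans ?_
      rw [if_neg hi0]
      refine ih i ?_
      push_cast
      omega

theorem nth_eq_default_of_lt_abs {T : Tape Γ} {B : ℕ} (hl : ∀ i, T.left.nth i = default)
    (hr : ∀ i, B ≤ i → T.right.nth i = default) (i : ℤ) (hi : B < |i|) :
    T.nth i = default := by
  rcases i with (_ | i) | i
  · simp at hi
    omega
  · refine hr i ?_
    have : |Int.ofNat (i + 1)| = i + 1 := abs_of_nonneg (Int.natCast_nonneg _)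
    omega
  · exact hl i

end

/-! ### From stack machines to Post-Turing machines -/

section
variable {K : Type} [DecidableEq K] {Γ : K → Type} {Λ σ : Type} [Inhabited Λ] [Inhabited σ]

/-- The Post-Turing machine that simulates a machine with several stacks. -/
def stackMachine (M : Λ → TM2.Stmt Γ Λ σ) :
    TM0.Machine (TM2to1.Γ' K Γ) (TM1to0.Λ' (TM2to1.tr M)) :=
  TM1to0.tr (TM2to1.tr M)

/-- Finitely many states suffice, which lets the machine table fit into a finite database. -/
theorem exists_supports_stackMachine [Fintype σ] {M : Λ → TM2.Stmt Γ Λ σ} {S : Finset Λ}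
    (ss : TM2.Supports M S) :
    ∃ S' : Set (TM1to0.Λ' (TM2to1.tr M)), S'.Finite ∧ TM0.Supports (stackMachine M) S' :=
  ⟨_, Finset.finite_toSet _, TM1to0.tr_supports _ (TM2to1.tr_supports M ss)⟩

theorem stackMachine_dom_iff (M : Λ → TM2.Stmt Γ Λ σ) (k : K) (L : List (Γ k)) :
    (StateTransition.eval (TM0.step (stackMachine M)) (TM0.init (TM2to1.trInit k L))).Dom ↔
      (TM2.eval M k L).Dom := by
  rw [← TM2to1.tr_eval_dom, ← TM1to0.tr_eval]
  rfl

/-- Each entry of the output stack occupies its own tape cell, on the track of stack `k`. A long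
output thus needs many non-blank cells, and hence many steps. -/
theorem nth_ne_default_of_mem_eval {M : Λ → TM2.Stmt Γ Λ σ} {k : K} {L L₂ : List (Γ k)}
    {c : TM0.Cfg (TM2to1.Γ' K Γ) (TM1to0.Λ' (TM2to1.tr M))}
    (hc : c ∈ StateTransition.eval (TM0.step (stackMachine M)) (TM0.init (TM2to1.trInit k L)))
    (h₂ : L₂ ∈ TM2.eval M k L) {i : ℕ} (hi : i < L₂.length) : c.Tape.nth i ≠ default := by
  have h₁ : c.Tape.right₀ ∈ TM1.eval (TM2to1.tr M) (TM2to1.trInit k L) := by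
    rw [← TM1to0.tr_eval]
    exact Part.mem_map _ hc
  obtain ⟨S, L', hL', hS, rfl⟩ := TM2to1.tr_eval M k L h₁ h₂
  intro hdef
  have h := TM2to1.addBottom_nth_snd L' i
  rw [hL', Tape.right₀_nth, hdef] at h
  have h3 := congrArg (fun l => ListBlank.nth l i) (hS k)
  simp only [proj_map_nth, ← h, ListBlank.nth_mk] at h3
  rw [List.getI_eq_getElem _ (by simpa using hi)] at h3
  simp only [List.getElem_reverse, List.getElem_map] at h3
  exact absurd h3 (by rintro ⟨⟩)

end

/-! ### Unary input and output through the numbers `2 ^ n - 1` -/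

namespace UniversalMachine
open PartrecToTM2 ToPartrec

instance : Finite K' :=
  Finite.of_injective (fun k : K' => match k with
    | .main => (0 : Fin 4)
    | .rev => 1
    | .aux => 2
    | .stack => 3) (by rintro (_ | _) (_ | _) <;> simp)

/-- The inverse of `n ↦ 2 ^ n - 1`. -/
def logSucc (N : ℕ) : ℕ := N.findGreatest fun k => 2 ^ k - 1 ≤ N

theorem logSucc_two_pow_sub_one (n : ℕ) : logSucc (2 ^ n - 1) = n := by
  have hle : ∀ k, k ≤ 2 ^ k - 1 := fun k => Nat.le_sub_one_of_lt Nat.lt_two_pow_self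
  refine Nat.findGreatest_eq_iff.2 ⟨hle n, fun _ => le_rfl, fun k hk _ hk' => ?_⟩
  have := Nat.pow_lt_pow_right (by norm_num : 1 < 2) hk
  have := Nat.one_le_two_pow (n := n)
  omega

theorem primrec_two_pow_sub_one : Primrec fun n : ℕ => 2 ^ n - 1 :=
  Primrec.nat_sub.comp
    ((Primrec₂.unpaired'.1 Nat.Primrec.pow).comp (Primrec.const 2) Primrec.id) (Primrec.const 1)

theorem primrec_logSucc : Primrec logSucc :=
  Primrec.nat_findGreatest Primrec.id
    (Primrec.nat_le.comp₂ (primrec_two_pow_sub_one.comp Primrec.snd) Primrec.fst)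

/-- The compiled machine works in binary, and `2 ^ n - 1` consists of `n` ones. This gives uniform
input cells and an output whose length is linear in `m`. -/
theorem trNat_two_pow_sub_one (n : ℕ) : trNat (2 ^ n - 1) = List.replicate n Γ'.bit1 := by
  induction n with
  | zero => simp
  | succ n ih =>
    have h : 2 ^ (n + 1) - 1 = 2 * (2 ^ n - 1) + 1 := by
      have := Nat.one_le_two_pow (n := n)
      omega
    have h2 : ((2 * (2 ^ n - 1) + 1 : ℕ) : Num) = Num.bit1 ((2 ^ n - 1 : ℕ) : Num) := by
      rw [two_mul, Nat.cast_succ, Nat.cast_add, Num.bit1_of_bit1]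
    rw [h, trNat, h2, List.replicate_succ, ← ih, trNat]
    cases ((2 ^ n - 1 : ℕ) : Num) <;> rfl

theorem trList_two_pow_sub_one (n : ℕ) :
    trList [2 ^ n - 1] = List.replicate n Γ'.bit1 ++ [Γ'.cons] := by
  simp [trNat_two_pow_sub_one]

/-- A machine symbol for a cell that holds a symbol of the main stack. -/
def mainSymbol (bottom : Bool) (a : Γ') : TM2to1.Γ' K' fun _ => Γ' :=
  (bottom, Function.update (fun _ => none) K'.main (some a))

theorem trInit_two_pow_sub_one (n : ℕ) :
    TM2to1.trInit (Γ := fun _ => Γ') K'.main (trList [2 ^ n - 1]) =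
      mainSymbol true .cons :: List.replicate n (mainSymbol false .bit1) := by
  rw [trList_two_pow_sub_one]
  simp only [TM2to1.trInit, List.reverse_append, List.reverse_replicate]
  exact congrArg (mainSymbol true .cons :: ·) List.map_replicate

theorem eval_main (c : Code) (v : List ℕ) :
    @TM2.eval K' (fun _ => Γ') Λ' (Option Γ') ⟨trNormal c .halt⟩ _ _ tr K'.main (trList v) =
      (c.eval v).map trList := by
  have h : @TM2.init K' (fun _ => Γ') Λ' (Option Γ') ⟨trNormal c .halt⟩ _ _ K'.main (trList v) =
      init c v := by
    refine congrArg (TM2.Cfg.mk _ _) ?_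
    funext k
    cases k <;> rfl
  let _ : Inhabited Λ' := ⟨trNormal c .halt⟩
  refine (congrArg (fun x => (StateTransition.eval (TM2.step tr) x).map fun c => c.stk K'.main)
    h).trans ?_
  rw [tr_eval, Part.map_eq_map]
  exact Part.map_map _ _ _

end UniversalMachine

open PartrecToTM2 UniversalMachine in
/-- For every partial recursive function `u` there is a Turing machine that, started on `n` cells
with the same symbol, halts if and only if `u n` is defined, after at least `u n - n` steps. -/
theorem exists_machine {u : ℕ →. ℕ} (hu : Partrec u) :
    ∃ (Γ Λ : Type) (_ : Inhabited Γ) (_ : Inhabited Λ) (_ : Finite Γ) (M : TM0.Machine Γ Λ)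
      (S : Set Λ) (a₀ b : Γ), S.Finite ∧ TM0.Supports M S ∧
      ∀ n, ∃ T : Tape Γ, T.head = a₀ ∧ (∀ i, T.left.nth i = default) ∧
        (∀ i, T.right.nth i = if i < n then b else default) ∧
        ((StateTransition.eval (TM0.step M) ⟨default, T⟩).Dom ↔ (u n).Dom) ∧
        ∀ m ∈ u n, ∃ k, m ≤ n + k ∧ ∃ c', c' ∈ stepN M ⟨default, T⟩ k := by
  -- Conjugating `u` by `n ↦ 2 ^ n - 1` turns binary input and output into unary.
  have hv : Partrec fun N => (u (logSucc N)).map fun m => 2 ^ m - 1 :=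
    (hu.comp primrec_logSucc.to_comp).map (primrec_two_pow_sub_one.comp Primrec.snd).to_comp
  obtain ⟨c, hc⟩ := ToPartrec.Code.exists_code (Nat.Partrec'.part_iff₁.2 hv)
  let _ : Inhabited Λ' := ⟨trNormal c .halt⟩
  obtain ⟨S, hS, hS'⟩ := exists_supports_stackMachine (tr_supports c .halt)
  have heval : ∀ n, TM2.eval tr K'.main (trList [2 ^ n - 1]) =
      (u n).map fun m => trList [2 ^ m - 1] := by
    intro n
    refine (eval_main c [2 ^ n - 1]).trans ?_
    have h := hc ⟨[2 ^ n - 1], rfl⟩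
    simp only [List.Vector.head, logSucc_two_pow_sub_one] at h
    rw [h, Part.map_eq_map, Part.map_map, Part.map_map]
    rfl
  refine ⟨TM2to1.Γ' K' fun _ => Γ', _, inferInstance, inferInstance,
    inferInstanceAs (Finite (Bool × (K' → Option Γ'))), stackMachine tr, S,
    mainSymbol true .cons, mainSymbol false .bit1, hS, hS',
    fun n => ⟨(TM0.init (Λ := TM1to0.Λ' (TM2to1.tr tr))
      (TM2to1.trInit (Γ := fun _ => Γ') K'.main (trList [2 ^ n - 1]))).Tape, ?_⟩⟩
  have hleft : ∀ i, (TM0.init (Λ := TM1to0.Λ' (TM2to1.tr tr))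
      (TM2to1.trInit (Γ := fun _ => Γ') K'.main (trList [2 ^ n - 1]))).Tape.left.nth i =
        default := by
    intro i
    rw [trInit_two_pow_sub_one]
    rfl
  have hright : ∀ i, (TM0.init (Λ := TM1to0.Λ' (TM2to1.tr tr))
      (TM2to1.trInit (Γ := fun _ => Γ') K'.main (trList [2 ^ n - 1]))).Tape.right.nth i =
        if i < n then mainSymbol false .bit1 else default := by
    intro i
    rw [trInit_two_pow_sub_one]
    refine (ListBlank.nth_mk (List.replicate n (mainSymbol false .bit1)) i).trans ?_
    split_ifs with hi
    · rw [List.getI_eq_getElem _ (by simpa using hi), List.getElem_replicate]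
    · exact List.getI_eq_default _ (by simpa using hi)
  refine ⟨?_, hleft, hright, ?_, ?_⟩
  · rw [trInit_two_pow_sub_one]
    rfl
  · refine (stackMachine_dom_iff tr K'.main (trList [2 ^ n - 1])).trans ?_
    rw [heval]
    rfl
  · intro m hm
    have h₂ : trList [2 ^ m - 1] ∈ TM2.eval tr K'.main (trList [2 ^ n - 1]) := by
      rw [heval]
      exact Part.mem_map _ hm
    obtain ⟨c', hc'⟩ := Part.dom_iff_mem.1
      ((stackMachine_dom_iff tr K'.main (trList [2 ^ n - 1])).2 (Part.dom_iff_mem.2 ⟨_, h₂⟩))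
    obtain ⟨k, hk⟩ := exists_stepN_of_reaches (StateTransition.mem_eval.1 hc').1
    refine ⟨k, ?_, c', hk⟩
    by_contra hlt
    -- The output has length `m + 1`, counting the separator, so cell `m` is not blank; yet after
    -- `k` steps everything beyond distance `n + k` is still blank.
    refine nth_ne_default_of_mem_eval hc' h₂ (i := m) ?_
      (nth_eq_default_of_mem_stepN (B := n)
        (nth_eq_default_of_lt_abs hleft fun i hi => ?_) hk m ?_)
    · rw [trList_two_pow_sub_one]
      simp
    · rw [hright, if_neg (by omega)]
    · rw [Nat.abs_cast]
      omega

/-! ### The databases -/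

section
variable {Γ Λ : Type} [Inhabited Λ]

/-- An entry of the table of a machine as a fact. -/
def entryFact (κ : Λ → ℕ) (γ : Γ → ℕ) (q : Λ) (a : Γ) : Λ × TM0.Stmt Γ → Fact
  | (q', .move d) => moveA d (κ q) (γ a) (κ q')
  | (q', .write b) => writeA (κ q) (γ a) (κ q') (γ b)

theorem exists_table [Finite Γ] (M : TM0.Machine Γ Λ) {S : Set Λ} (hS : S.Finite) (κ : Λ → ℕ)
    (γ : Γ → ℕ) : ∃ table : List Fact, ∀ x, x ∈ table ↔
      ∃ q ∈ S, ∃ a p, M q a = some p ∧ x = entryFact κ γ q a p := by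
  have hfin : {x | ∃ q ∈ S, ∃ a p, M q a = some p ∧ x = entryFact κ γ q a p}.Finite := by
    have h : (⋃ q ∈ S, ⋃ a, entryFact κ γ q a '' {p | M q a = some p}).Finite := by
      refine hS.biUnion fun q _ => Set.finite_iUnion fun a => Set.Finite.image _ ?_
      refine Set.Subsingleton.finite fun p hp p' hp' => ?_
      exact Option.some.inj (Eq.trans (Eq.symm hp) hp')
    refine h.subset ?_
    rintro x ⟨q, hq, a, p, hp, rfl⟩
    exact Set.mem_biUnion hq (Set.mem_iUnion.2 ⟨a, p, hp, rfl⟩)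
  exact ⟨hfin.toFinset.toList, fun x => by simp⟩

/-- The facts of the database for the input `n`. -/
def inputFacts (table : List Fact) (q₀ a₀ blank one n : ℕ) : List Fact :=
  table ++ confA 0 0 q₀ 0 a₀ n ::
    (List.range (n + 1)).map fun c => cellA c (if c = 0 then blank else one) (c - 1)

theorem computable_inputFacts (table : List Fact) (q₀ a₀ blank one : ℕ) :
    Computable fun n => (inputFacts table q₀ a₀ blank one n).map Fact.code := by
  have h : ∀ n, (inputFacts table q₀ a₀ blank one n).map Fact.code = table.map Fact.code ++
      (0, [0, 0, q₀, 0, a₀, n]) :: (List.range (n + 1)).map fun c =>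
        (1, [c, if c = 0 then blank else one, c - 1]) := by
    intro n
    simp only [inputFacts, List.map_append, List.map_cons, List.map_map]
    rfl
  have hconf : Primrec fun n : ℕ => ((0, [0, 0, q₀, 0, a₀, n]) : ℕ × List ℕ) := by
    refine (Primrec.const 0).pair ?_
    have : Primrec fun n : ℕ => [n] := Primrec.list_cons.comp Primrec.id (Primrec.const [])
    exact (Primrec.list_append.comp (Primrec.const [0, 0, q₀, 0, a₀]) this)
  have hcell : Primrec fun c : ℕ =>
      ((1, [c, if c = 0 then blank else one, c - 1]) : ℕ × List ℕ) := by
    refine (Primrec.const 1).pair ?_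
    refine Primrec.list_cons.comp Primrec.id (Primrec.list_cons.comp ?_
      (Primrec.list_cons.comp Primrec.pred (Primrec.const [])))
    exact Primrec.ite (Primrec.eq.comp Primrec.id (Primrec.const 0)) (Primrec.const _)
      (Primrec.const _)
  refine (Primrec.to_comp ?_ : Computable fun n => table.map Fact.code ++
      (0, [0, 0, q₀, 0, a₀, n]) :: (List.range (n + 1)).map fun c =>
        (1, [c, if c = 0 then blank else one, c - 1])).of_eq fun n => (h n).symm
  exact Primrec.list_append.comp (Primrec.const _) (Primrec.list_cons.comp hconf
    (Primrec.list_map (Primrec.list_range.comp Primrec.succ) (hcell.comp Primrec.snd).to₂))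

theorem holdsMachine_inputFacts [Inhabited Γ] {M : TM0.Machine Γ Λ} {S : Set Λ}
    (ss : TM0.Supports M S) {κ : Λ → ℕ} (hκ : Set.InjOn κ S) {γ : Γ → ℕ} (hγ : Function.Injective γ)
    {table : List Fact} (htable : ∀ x, x ∈ table ↔
      ∃ q ∈ S, ∃ a p, M q a = some p ∧ x = entryFact κ γ q a p) (a₀ b : Γ) {n : ℕ}
    {D : Database} (hD : ∀ x, x ∈ D ↔
      x ∈ inputFacts table (κ default) (γ a₀) (γ default) (γ b) n) :
    HoldsMachine M S κ γ (fun c => if c = 0 then γ default else γ b) a₀ n D := by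
  have hD' : ∀ x, x ∈ D ↔ (∃ q ∈ S, ∃ a p, M q a = some p ∧ x = entryFact κ γ q a p) ∨
      x = confA 0 0 (κ default) 0 (γ a₀) n ∨
      ∃ c < n + 1, cellA c (if c = 0 then γ default else γ b) (c - 1) = x := by
    intro x
    rw [hD, inputFacts, List.mem_append, htable, List.mem_cons, List.mem_map]
    simp only [List.mem_range]
  refine ⟨ss, hκ, hγ, ?_, ?_, ?_, ?_, ?_, ?_, ?_, ?_⟩
  · exact fun q hq a q' d hM => (hD' _).2 (.inl ⟨q, hq, a, _, hM, rfl⟩)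
  · exact fun q hq a q' d hM => (hD' _).2 (.inl ⟨q, hq, a, _, hM, rfl⟩)
  · intro d x y z h
    rcases (hD' _).1 h with ⟨q, hq, a, ⟨q', e | b⟩, hM, h⟩ | h | ⟨c, -, h⟩
    · have h' := moveA_inj.1 h
      exact ⟨q, hq, a, q', h'.1 ▸ hM, h'.2⟩
    · exact absurd h moveA_ne_writeA
    · exact absurd h.symm confA_ne_moveA
    · exact absurd h cellA_ne_moveA
  · intro x y z w h
    rcases (hD' _).1 h with ⟨q, hq, a, ⟨q', e | b⟩, hM, h⟩ | h | ⟨c, -, h⟩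
    · exact absurd h.symm moveA_ne_writeA
    · exact ⟨q, hq, a, q', b, hM, writeA_inj.1 h⟩
    · exact absurd h.symm confA_ne_writeA
    · exact absurd h cellA_ne_writeA
  · exact (hD' _).2 (.inr (.inl rfl))
  · intro p t q l s r h
    rcases (hD' _).1 h with ⟨q, hq, a, ⟨q', e | b⟩, hM, h⟩ | h | ⟨c, -, h⟩
    · exact absurd h confA_ne_moveA
    · exact absurd h confA_ne_writeA
    · exact h
    · exact absurd h.symm confA_ne_cellA
  · exact fun c hc => (hD' _).2 (.inr (.inr ⟨c, Nat.lt_succ_of_le hc, rfl⟩))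
  · intro z s w h
    rcases (hD' _).1 h with ⟨q, hq, a, ⟨q', e | b⟩, hM, h⟩ | h | ⟨c, -, h⟩
    · exact absurd h cellA_ne_moveA
    · exact absurd h cellA_ne_writeA
    · exact absurd h.symm confA_ne_cellA
    · obtain ⟨rfl, rfl, rfl⟩ := cellA_inj.1 h
      exact ⟨rfl, rfl⟩

end

/-- For every partial recursive function `u` there are computable databases for which the chase
with the rules is finite if and only if `u n` is defined, and has then at least `u n - n` atoms. -/
theorem exists_databases {u : ℕ →. ℕ} (hu : Partrec u) :
    ∃ facts : ℕ → List Fact, (Computable fun n => (facts n).map Fact.code) ∧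
      ∀ n (D : Database), (∀ x, x ∈ facts n ↔ x ∈ D) →
        ((leastClosed D machineRules).Finite ↔ (u n).Dom) ∧
          ∀ m ∈ u n, m < n + (leastClosed D machineRules).ncard := by
  obtain ⟨Γ, Λ, _, _, _, M, S, a₀, b, hS, ss, hM⟩ := exists_machine hu
  obtain ⟨κ, hκ⟩ := Set.countable_iff_exists_injOn.1 hS.countable
  obtain ⟨γ, hγ⟩ := exists_injective_nat Γ
  obtain ⟨table, htable⟩ := exists_table M hS κ γ
  refine ⟨inputFacts table (κ default) (γ a₀) (γ default) (γ b), computable_inputFacts _ _ _ _ _,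
    fun n D hD => ?_⟩
  obtain ⟨T, hhead, hleft, hright, hdom, hsteps⟩ := hM n
  have H := holdsMachine_inputFacts ss hκ hγ htable a₀ b fun x => (hD x).symm
  have h0 := H.simulates hhead hleft (fun i => by
    rw [hright]
    by_cases hi : i < n
    -- The cells of the constant `n` are `n, n - 1, …, 1`, all holding `b`, and then `0`, which is
    -- blank forever.
    · rw [if_pos hi, if_neg (by omega)]
    · rw [if_neg hi, if_pos (by omega)]) (if_pos rfl)
  have hfin := (finite_leastClosed_iff H h0).trans hdom
  refine ⟨hfin, fun m hm => ?_⟩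
  obtain ⟨k, hk, c', hc'⟩ := hsteps m hm
  have := lt_ncard_leastClosed H h0 hc' (hfin.2 (Part.dom_iff_mem.2 ⟨m, hm⟩))
  omega

/-- A universal partial recursive function. -/
def universal (n : ℕ) : Part ℕ :=
  (Denumerable.ofNat Nat.Partrec.Code n.unpair.1).eval n.unpair.2

theorem partrec_universal : Partrec universal :=
  Nat.Partrec.Code.eval_part.comp
    ((Computable.ofNat Nat.Partrec.Code).comp (Computable.fst.comp Computable.unpair))
    (Computable.snd.comp Computable.unpair)

theorem universal_pair (c : Nat.Partrec.Code) (n : ℕ) :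
    universal (Nat.pair (Encodable.encode c) n) = c.eval n := by
  simp [universal]

open Classical in
/-- If the chase is finite for some of the databases exactly when a universal function is defined,
then finiteness is undecidable. -/
theorem not_decidableOnDatabases {facts : ℕ → List Fact}
    (hc : Computable fun n => (facts n).map Fact.code) {P : Database → Prop}
    (hP : ∀ n, P (facts n).toFinset ↔ (universal n).Dom) : ¬ DecidableOnDatabases P := by
  rintro ⟨g, hg, h⟩
  refine ComputablePred.halting_problem 0 (ComputablePred.computable_iff.2
    ⟨fun c => g ((facts (Nat.pair (Encodable.encode c) 0)).map Fact.code), ?_, ?_⟩)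
  · exact hg.comp (hc.comp
      (Primrec₂.natPair.to_comp.comp Computable.encode (Computable.const 0)))
  · funext c
    refine propext ?_
    rw [h (facts (Nat.pair (Encodable.encode c) 0)).toFinset _ (fun a => List.mem_toFinset.symm),
      hP, universal_pair]

end Chase

theorem mainTheorem12 :
    ∃ S : Finset Chase.TGD,
      (∀ f : Chase.Database → ℕ, Chase.ComputableOnDatabases f →
        ∃ D : Chase.Database,
          S ∈ Chase.CTForall D ∧ S ∈ Chase.CTExists D ∧
          ∃ C : Chase.Inst, Chase.IsChase D S C ∧ C.Finite ∧ f D < C.ncard) ∧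
      ¬ Chase.DecidableOnDatabases (fun D => S ∈ Chase.CTForall D) ∧
      ¬ Chase.DecidableOnDatabases (fun D => S ∈ Chase.CTExists D) := by
  classical
  obtain ⟨facts, hc, hfacts⟩ := Chase.exists_databases Chase.partrec_universal
  have hdb := fun n => hfacts n (facts n).toFinset fun x => List.mem_toFinset.symm
  refine ⟨Chase.machineRules, ?_,
    Chase.not_decidableOnDatabases hc fun n => Chase.mem_CTForall_iff.trans (hdb n).1,
    Chase.not_decidableOnDatabases hc fun n => Chase.mem_CTExists_iff.trans (hdb n).1⟩
  rintro f ⟨g, hg, hgf⟩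
  have hpair : Computable fun x : ℕ => Nat.pair x x :=
    (Primrec₂.natPair.comp Primrec.id Primrec.id).to_comp
  -- Diagonalization: the code `e` of this function, applied to itself, makes `universal n` equal to
  -- `f` of the database for `n`, plus `n`. The summand `n` offsets the loss of the input length in
  -- the bound on the chase.
  have hcomp : Computable fun x : ℕ =>
      g ((facts (Nat.pair x x)).map Chase.Fact.code) + Nat.pair x x :=
    Primrec.nat_add.to_comp.comp (hg.comp (hc.comp hpair)) hpair
  obtain ⟨e, he⟩ := Nat.Partrec.Code.exists_code.1 (Partrec.nat_iff.1 hcomp)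
  set n := Nat.pair (Encodable.encode e) (Encodable.encode e) with hn
  have hmem : f (facts n).toFinset + n ∈ Chase.universal n := by
    rw [hn, Chase.universal_pair, he, ← hn,
      ← hgf _ (facts n) (fun x => List.mem_toFinset.symm)]
    exact Part.mem_some _
  have hfin := (hdb n).1.2 (Part.dom_iff_mem.2 ⟨_, hmem⟩)
  have hlt := (hdb n).2 _ hmem
  exact ⟨(facts n).toFinset, Chase.mem_CTForall_iff.2 hfin, Chase.mem_CTExists_iff.2 hfin, _,
    Chase.isChase_leastClosed _ _, hfin, by omega⟩
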